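/- \textbf{Setting.} Let $M^n$, $\bar M^n$ be smooth manifolds (without boundary) of the same dimension $n$. A \emph{Kim--McCann structure} on $M\times\bar M$ consists of a closed set $\mathscr C\subset M\times\bar M$ (the cut locus) and a pseudo-Riemannian metric $h$ on $(M\times\bar M)\setminus\mathscr C$ which vanishes on pairs of vectors tangent to the same factor and such that every $(x_0,\bar x_0)\notin\mathscr C$ has a neighbourhood with a $C^4$ function $c$ on it satisfying $h(V,\bar W)=-\tfrac12\,V\bar W c$ for all $V\in T_xM$, $\bar W\in T_{\bar x}\bar M$ and all $(x,\bar x)$ in this neighbourhood. Let $K=I_{T_xM}\oplus(-I)_{T_{\bar x}\bar M}$ be the para-complex structure and $\omega=h(K\cdot,\cdot)$ the para-K\"ahler form. Let $\hat\nabla$ be the Levi-Civita connection of $h$, $\hat R(X,Y)Z=\hat\nabla_X\hat\nabla_YZ-\hat\nabla_Y\hat\nabla_XZ-\hat\nabla_{[X,Y]}Z$, and $\hat{R}ic(Y,Z)=\operatorname{tr}\bigl(X\mapsto\hat R(X,Y)Z\bigr)$. Let $L^n$ be a smooth $n$-manifold and $F:L\to(M\times\bar M)\setminus\mathscr C$ an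 immersion of class $C^3$ which is Lagrangian, $F^*\omega=0$, and whose induced metric $g=F^*h$ is nondegenerate (for example, $F$ spacelike). Let $\vec H=g^{ij}\bigl(\hat\nabla_{\partial_iF}\,\partial_jF\bigr)^{\perp}$ be its mean curvature vector, and let $F^*\alpha_{\vec H}$ be the mean curvature form on $L$, $(F^*\alpha_{\vec H})(v)=\omega(\vec H,dF(v))$. \textbf{Theorem} (analogue of Dazord's theorem). The $1$-form $F^*\alpha_{\vec H}$ is of class $C^1$, and \[ d\bigl(F^*\alpha_{\vec H}\bigr)=F^*\bigl(\hat{R}ic(K\cdot,\cdot)\bigr)\quad\text{on } L, \] that is, $d(F^*\alpha_{\vec H})(u,v)=\hat{R}ic\bigl(K\,dF(u),dF(v)\bigr)$ for all $p\in L$ and $u,v\in T_pL$, where $d\alpha(X,Y)=X\alpha(Y)-Y\alpha(X)-\alpha([X,Y])$. -/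

import Mathlib

open scoped Manifold ContDiff Topology

noncomputable section

namespace KimMcCann

/-! ### Pseudo-Riemannian calculus in a vector space

`G y` is the matrix of a metric at the point `y` of a coordinate domain in `V`. -/

section Local

variable {V : Type*} [NormedAddCommGroup V] [NormedSpace ℝ V]
  {E : Type*} [NormedAddCommGroup E] [NormedSpace ℝ E]

/-- Christoffel symbols of the first kind:
`(u, v, w) ↦ (1/2) (∂_u G(v, w) + ∂_v G(u, w) - ∂_w G(u, v))`. -/
def christoffelFirst (G : V → V →L[ℝ] V →L[ℝ] ℝ) (y u v : V) : V →L[ℝ] ℝ :=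
  (1 / 2 : ℝ) • (fderiv ℝ G y u v + fderiv ℝ G y v u - ((fderiv ℝ G y).flip u).flip v)

/-- Christoffel symbols of the second kind: `christoffel G y u v` is the vector with
`G y (christoffel G y u v) w = christoffelFirst G y u v w`, i.e. `∇_u v` at `y` for vector fields
`u`, `v` with constant coefficients. -/
def christoffel (G : V → V →L[ℝ] V →L[ℝ] ℝ) (y u v : V) : V :=
  (G y).inverse (christoffelFirst G y u v)

/-- The curvature `R(u, v) z = ∇_u ∇_v z - ∇_v ∇_u z` at `y`, for vector fields `u`, `v`, `z` with
constant coefficients. -/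
def curvature (G : V → V →L[ℝ] V →L[ℝ] ℝ) (y u v z : V) : V :=
  fderiv ℝ (fun y' => christoffel G y' v z) y u - fderiv ℝ (fun y' => christoffel G y' u z) y v
    + christoffel G y u (christoffel G y v z) - christoffel G y v (christoffel G y u z)

/-- The Ricci tensor `Ric(v, z) = tr (u ↦ R(u, v) z)` at `y` (the trace is computed in a basis). -/
def localRicci [FiniteDimensional ℝ V] (G : V → V →L[ℝ] V →L[ℝ] ℝ) (y v z : V) : ℝ :=
  ∑ i, (Module.finBasis ℝ V).coord i (curvature G y (Module.finBasis ℝ V i) v z)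

/-- The metric induced by a parametrization `f` at `x`: `g(a, b) = G(∂_a f, ∂_b f)`. -/
def inducedMetric (G : V → V →L[ℝ] V →L[ℝ] ℝ) (f : E → V) (x : E) : E →L[ℝ] E →L[ℝ] ℝ :=
  (G (f x)).bilinearComp (fderiv ℝ f x) (fderiv ℝ f x)

/-- The normal component `w^⊥` of an ambient vector `w` at `f x`: the tangential component that is
subtracted is `∂_a f` for the `a` with `g(a, b) = G(w, ∂_b f)` for all `b`. -/
def normalPart (G : V → V →L[ℝ] V →L[ℝ] ℝ) (f : E → V) (x : E) (w : V) : V :=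
  w - fderiv ℝ f x ((inducedMetric G f x).inverse ((G (f x) w).comp (fderiv ℝ f x)))

/-- The second fundamental form `A(∂_a f, ∂_b f) = (∇_{∂_a f} ∂_b f)^⊥`. -/
def secondFundamentalForm (G : V → V →L[ℝ] V →L[ℝ] ℝ) (f : E → V) (x a b : E) : V :=
  normalPart G f x
    (fderiv ℝ (fderiv ℝ f) x a b + christoffel G (f x) (fderiv ℝ f x a) (fderiv ℝ f x b))

/-- The mean curvature vector `g^{ij} A(∂_i f, ∂_j f)` of a parametrization `f` defined on a
domain of `ℝⁿ`. -/
def localMeanCurvature {n : ℕ} (G : V → V →L[ℝ] V →L[ℝ] ℝ) (f : EuclideanSpace ℝ (Fin n) → V)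
    (x : EuclideanSpace ℝ (Fin n)) : V :=
  let e := EuclideanSpace.basisFun (Fin n) ℝ
  let g : Matrix (Fin n) (Fin n) ℝ := Matrix.of fun i j => inducedMetric G f x (e i) (e j)
  ∑ i, ∑ j, g⁻¹ i j • secondFundamentalForm G f x (e i) (e j)

end Local

/-! ### Tensor fields on manifolds, seen in charts -/

section Manifold

variable {V : Type*} [NormedAddCommGroup V] [NormedSpace ℝ V]
  {H : Type*} [TopologicalSpace H] (I : ModelWithCorners ℝ V H)
  {X : Type*} [TopologicalSpace X] [ChartedSpace H X]

/-- The expression of a field `h` of bilinear forms in the preferred chart at `q`. -/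
def chartMetric (h : ∀ q : X, TangentSpace I q →L[ℝ] TangentSpace I q →L[ℝ] ℝ) (q : X) :
    V → V →L[ℝ] V →L[ℝ] ℝ := fun y =>
  let A : V →L[ℝ] V := mfderiv 𝓘(ℝ, V) I (extChartAt I q).symm y
  let B : V →L[ℝ] V →L[ℝ] ℝ := h ((extChartAt I q).symm y)
  B.bilinearComp A A

/-- The Ricci tensor of the metric `h` at `q`, computed in the preferred chart at `q`. -/
def ricci [FiniteDimensional ℝ V]
    (h : ∀ q : X, TangentSpace I q →L[ℝ] TangentSpace I q →L[ℝ] ℝ) (q : X)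
    (u v : TangentSpace I q) : ℝ :=
  localRicci (chartMetric I h q) (extChartAt I q q)
    (mfderiv I 𝓘(ℝ, V) (extChartAt I q) q u) (mfderiv I 𝓘(ℝ, V) (extChartAt I q) q v)

/-- The expression of a `1`-form `α` in the preferred chart at `q`. -/
def chartForm (α : ∀ q : X, TangentSpace I q →L[ℝ] ℝ) (q : X) : V → V →L[ℝ] ℝ := fun y =>
  let A : V →L[ℝ] V := mfderiv 𝓘(ℝ, V) I (extChartAt I q).symm y
  let β : V →L[ℝ] ℝ := α ((extChartAt I q).symm y)
  β.comp A

/-- `α` is a `1`-form of class `C¹`. -/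
def IsC1Form (α : ∀ q : X, TangentSpace I q →L[ℝ] ℝ) : Prop :=
  ∀ q : X, ContDiffAt ℝ 1 (chartForm I α q) (extChartAt I q q)

/-- The exterior derivative `dα(u, v) = ∂_u α(v) - ∂_v α(u)` (constant coefficient extensions of
`u` and `v` in the preferred chart at `q`). -/
def extDerivForm (α : ∀ q : X, TangentSpace I q →L[ℝ] ℝ) (q : X) (u v : TangentSpace I q) : ℝ :=
  let D : V →L[ℝ] V →L[ℝ] ℝ := fderiv ℝ (chartForm I α q) (extChartAt I q q)
  let u' : V := mfderiv I 𝓘(ℝ, V) (extChartAt I q) q u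
  let v' : V := mfderiv I 𝓘(ℝ, V) (extChartAt I q) q v
  D u' v' - D v' u'

/-- The mean curvature vector at `F p` of an immersion `F : L → X` into a manifold with metric `h`,
computed in the preferred charts at `p` and `F p`. -/
def meanCurvature {n : ℕ} {L : Type*} [TopologicalSpace L]
    [ChartedSpace (EuclideanSpace ℝ (Fin n)) L]
    (h : ∀ q : X, TangentSpace I q →L[ℝ] TangentSpace I q →L[ℝ] ℝ) (F : L → X) (p : L) :
    TangentSpace I (F p) :=
  let ψ := extChartAt I (F p)
  let A : V →L[ℝ] V := mfderiv 𝓘(ℝ, V) I ψ.symm (ψ (F p))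
  A (localMeanCurvature (chartMetric I h (F p)) (writtenInExtChartAt (𝓡 n) I p F)
    (extChartAt (𝓡 n) p p))

end Manifold

/-! ### Kim–McCann manifolds -/

section Product

variable {n : ℕ}
  {M : Type*} [TopologicalSpace M] [ChartedSpace (EuclideanSpace ℝ (Fin n)) M]
  {N : Type*} [TopologicalSpace N] [ChartedSpace (EuclideanSpace ℝ (Fin n)) N]

/-- The mixed second derivative `V W̄ c` at `q = (x, x̄)`, for `V ∈ T_x M` and `W̄ ∈ T_x̄ N`. -/
def crossDeriv (c : M × N → ℝ) (q : M × N) (v : TangentSpace (𝓡 n) q.1)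
    (w : TangentSpace (𝓡 n) q.2) : ℝ :=
  let Dw : M → ℝ := fun x => mfderiv (𝓡 n) 𝓘(ℝ, ℝ) (fun y : N => c (x, y)) q.2 w
  mfderiv (𝓡 n) 𝓘(ℝ, ℝ) Dw q.1 v

/-- The vector `v ⊕ w` of `T_(x, x̄) (M × N) = T_x M ⊕ T_x̄ N`. -/
def pair (q : M × N) (v : TangentSpace (𝓡 n) q.1) (w : TangentSpace (𝓡 n) q.2) :
    TangentSpace ((𝓡 n).prod (𝓡 n)) q := (v, w)

/-- The para-complex structure `K = I ⊕ (-I)` on `T_x M ⊕ T_x̄ N`. -/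
def paraK (q : M × N) :
    TangentSpace ((𝓡 n).prod (𝓡 n)) q →L[ℝ] TangentSpace ((𝓡 n).prod (𝓡 n)) q :=
  let E := EuclideanSpace ℝ (Fin n)
  let K : E × E →L[ℝ] E × E :=
    (ContinuousLinearMap.id ℝ E).prodMap (-ContinuousLinearMap.id ℝ E)
  K

variable (n M N) in
/-- A Kim–McCann structure on `M × N`: a pseudo-Riemannian metric `h` off the cut locus (its values
on the cut locus are irrelevant), for which the two factors are null and which is given locally by
the mixed second derivatives of a cost function of class `C⁴`. -/
structure Structure where
  /-- the metric -/
  h : ∀ q : M × N, TangentSpace ((𝓡 n).prod (𝓡 n)) q →L[ℝ]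
    TangentSpace ((𝓡 n).prod (𝓡 n)) q →L[ℝ] ℝ
  /-- the set where the metric is not well-defined -/
  cutLocus : Set (M × N)
  isClosed_cutLocus : IsClosed cutLocus
  symm : ∀ q ∉ cutLocus, ∀ u v, h q u v = h q v u
  nondegenerate : ∀ q ∉ cutLocus, ∀ u, (∀ v, h q u v = 0) → u = 0
  null_left : ∀ q ∉ cutLocus, ∀ v v', h q (pair q v 0) (pair q v' 0) = 0
  null_right : ∀ q ∉ cutLocus, ∀ w w', h q (pair q 0 w) (pair q 0 w') = 0
  exists_cost : ∀ q ∉ cutLocus, ∃ c : M × N → ℝ,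
    ContMDiffAt ((𝓡 n).prod (𝓡 n)) 𝓘(ℝ, ℝ) 4 c q ∧
    ∀ᶠ q' in 𝓝 q, ∀ v w, h q' (pair q' v 0) (pair q' 0 w) = -(1 / 2) * crossDeriv c q' v w

/-- The para-Kähler form `ω = h(K·, ·)`. -/
def Structure.omega (S : Structure n M N) (q : M × N) :
    TangentSpace ((𝓡 n).prod (𝓡 n)) q →L[ℝ] TangentSpace ((𝓡 n).prod (𝓡 n)) q →L[ℝ] ℝ :=
  (S.h q).comp (paraK q)

variable {L : Type*} [TopologicalSpace L] [ChartedSpace (EuclideanSpace ℝ (Fin n)) L]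

/-- `F` is a Lagrangian immersion of class `C³` of the `n`-manifold `L`, away from the cut locus. -/
structure Structure.IsLagrangianImmersion (S : Structure n M N) (F : L → M × N) : Prop where
  contMDiff : ContMDiff (𝓡 n) ((𝓡 n).prod (𝓡 n)) 3 F
  injective : ∀ p, Function.Injective (mfderiv (𝓡 n) ((𝓡 n).prod (𝓡 n)) F p)
  notMem_cutLocus : ∀ p, F p ∉ S.cutLocus
  lagrangian : ∀ (p : L) (u v : TangentSpace (𝓡 n) p),
    S.omega (F p) (mfderiv (𝓡 n) ((𝓡 n).prod (𝓡 n)) F p u)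
      (mfderiv (𝓡 n) ((𝓡 n).prod (𝓡 n)) F p v) = 0

/-- The induced metric `F^* h` is nondegenerate (for instance, `F` is spacelike). -/
def Structure.InducedNondegenerate (S : Structure n M N) (F : L → M × N) : Prop :=
  ∀ (p : L) (u : TangentSpace (𝓡 n) p),
    (∀ v : TangentSpace (𝓡 n) p, S.h (F p) (mfderiv (𝓡 n) ((𝓡 n).prod (𝓡 n)) F p u)
      (mfderiv (𝓡 n) ((𝓡 n).prod (𝓡 n)) F p v) = 0) → u = 0

/-- The pulled back mean curvature form `F^* α_H`, where `α_H = ω(H, ·)`. -/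
def Structure.meanCurvatureForm (S : Structure n M N) (F : L → M × N) (p : L) :
    TangentSpace (𝓡 n) p →L[ℝ] ℝ :=
  (S.omega (F p) (meanCurvature (n := n) ((𝓡 n).prod (𝓡 n)) S.h F p)).comp
    (mfderiv (𝓡 n) ((𝓡 n).prod (𝓡 n)) F p)

end Product

end KimMcCann

end

noncomputable section

namespace KimMcCann

open scoped InnerProductSpace

/-! ### The logarithm of the determinant and its derivative -/

section LogDet

variable {E : Type*} [NormedAddCommGroup E] [NormedSpace ℝ E]

/-! In product coordinates the metric is encoded by one field of endomorphisms `S = mixedEnd G (inL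
n) (inR n)`, which is -1/2 times the mixed Hessian of the cost: G(u, v) = ⟪S u₁, v₂⟫ + ⟪S v₁, u₂⟫.
Symmetry of the third derivatives of the cost makes the Christoffel symbols split into S⁻¹dS on the
first factor and S*⁻¹dS* on the second (`christoffel_eq`). Each block is flat along its own factor,
so only differentiation along the other factor contributes to the curvature trace. With Φ = log|det
S|, the Ricci tensor is therefore minus the mixed part of the Hessian of Φ (`localRicci_eq`).

Let P and Q be the two components of the derivative of a Lagrangian parametrization f. The
Lagrangian condition makes G(K∇_a∂_b f, ∂_v f) totally symmetric, so its g-trace over a and b is a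
difference of traces of endomorphisms. Jacobi's formula then gives the mean curvature form as ½
(d(log|det P| - log|det Q|) + dΦ ∘ K ∘ df) (`apply_localMeanCurvature`). The first term is closed.
The exterior derivative of the second consists of the mixed second derivatives of Φ, which is the
Ricci tensor with K inserted (`fderiv_logDetForm_sub`).

On manifolds, the mean curvature form at each point is computed in that point's own preferred
charts. To differentiate it in a single chart, the determinant expression must be shown independent
of coordinates (`logDetForm_comp`, `chartForm_meanCurvatureForm`). -/

theorem det_comp (A B : E →L[ℝ] E) : (A.comp B).det = A.det * B.det :=
  LinearMap.det_comp (A : E →ₗ[ℝ] E) B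

variable [FiniteDimensional ℝ E]

theorem contDiff_det {k : WithTop ℕ∞} : ContDiff ℝ k (fun A : E →L[ℝ] E => A.det) := by
  have h : (fun A : E →L[ℝ] E => A.det) = fun A : E →L[ℝ] E =>
      ∑ σ : Equiv.Perm (Fin (Module.finrank ℝ E)), (Equiv.Perm.sign σ : ℝ) *
        ∏ i, (Module.finBasis ℝ E).coord (σ i) (A (Module.finBasis ℝ E i)) := by
    funext A
    rw [ContinuousLinearMap.det, ← LinearMap.det_toMatrix (Module.finBasis ℝ E), Matrix.det_apply]
    simp [LinearMap.toMatrix_apply, Units.smul_def]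
  rw [h]
  refine ContDiff.sum fun σ _ => contDiff_const.mul (contDiff_prod fun i _ => ?_)
  exact (LinearMap.toContinuousLinearMap ((Module.finBasis ℝ E).coord (σ i))).contDiff.comp
    (contDiff_id.clm_apply contDiff_const)

/-- The trace, as a continuous linear functional on endomorphisms. -/
def traceCLM : (E →L[ℝ] E) →L[ℝ] ℝ :=
  LinearMap.toContinuousLinearMap
    ((LinearMap.trace ℝ E).comp (ContinuousLinearMap.coeLM ℝ : (E →L[ℝ] E) →ₗ[ℝ] E →ₗ[ℝ] E))

theorem traceCLM_apply (A : E →L[ℝ] E) : traceCLM A = LinearMap.trace ℝ E A := rfl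

theorem det_ne_zero_iff {A : E →L[ℝ] E} : A.det ≠ 0 ↔ A.IsInvertible := by
  constructor
  · intro h
    exact ⟨LinearEquiv.toContinuousLinearEquiv (LinearEquiv.ofIsUnitDet (f := (A : E →ₗ[ℝ] E))
      (v := Module.finBasis ℝ E) (v' := Module.finBasis ℝ E)
      (by rw [LinearMap.det_toMatrix]; exact isUnit_iff_ne_zero.2 h)), by ext; rfl⟩
  · rintro ⟨e, rfl⟩ h
    have := det_comp (e : E →L[ℝ] E) (e.symm : E →L[ℝ] E)
    rw [h, zero_mul, ContinuousLinearEquiv.coe_comp_coe_symm] at this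
    simp [ContinuousLinearMap.det] at this

/-- In a basis the determinant is 1 + t tr m + t² p(t) with p a polynomial, and only the linear term
survives at 0. -/
theorem hasDerivAt_det_one_add_smul (T : E →L[ℝ] E) :
    HasDerivAt (fun t : ℝ => (ContinuousLinearMap.id ℝ E + t • T).det) (traceCLM T) 0 := by
  set b := Module.finBasis ℝ E
  set m := LinearMap.toMatrix b b (T : E →ₗ[ℝ] E) with hm
  have h : ∀ t : ℝ, (ContinuousLinearMap.id ℝ E + t • T).det = (1 + t • m).det := by
    intro t
    rw [ContinuousLinearMap.det, ← LinearMap.det_toMatrix b]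
    congr 1
    rw [hm, ← LinearMap.toMatrix_id b, ← map_smul, ← map_add]
    rfl
  have ht : traceCLM T = m.trace := by
    rw [traceCLM_apply, LinearMap.trace_eq_matrix_trace ℝ b]
  rw [funext fun t => (h t).trans (Matrix.det_one_add_smul t m), ht]
  have h1 : HasDerivAt (fun t : ℝ => m.trace * t) m.trace 0 := by
    simpa using (hasDerivAt_id (0 : ℝ)).const_mul m.trace
  have h2 : ∀ p : Polynomial ℝ, HasDerivAt (fun t : ℝ => p.eval t * t ^ 2) 0 0 := fun p => by
    simpa using (p.hasDerivAt (0 : ℝ)).fun_mul (hasDerivAt_pow 2 (0 : ℝ))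
  simpa using (h1.const_add 1).fun_add (h2 _)

/-- The logarithm of the absolute value of the determinant. -/
def logDet (A : E →L[ℝ] E) : ℝ := Real.log A.det

/-- No orientation assumption is needed, since `Real.log` is the logarithm of the absolute value. -/
theorem logDet_comp {A B : E →L[ℝ] E} (hA : A.IsInvertible) (hB : B.IsInvertible) :
    logDet (A.comp B) = logDet A + logDet B := by
  rw [logDet, det_comp, Real.log_mul (det_ne_zero_iff.2 hA) (det_ne_zero_iff.2 hB)]; rfl

theorem contDiffAt_logDet {k : WithTop ℕ∞} {A : E →L[ℝ] E} (hA : A.IsInvertible) :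
    ContDiffAt ℝ k logDet A :=
  contDiff_det.contDiffAt.log (det_ne_zero_iff.2 hA)

/-- Jacobi's formula. Factoring A + tH = A(1 + tA⁻¹H) reduces the derivative along a line to the one
at the identity. -/
theorem fderiv_logDet {A : E →L[ℝ] E} (hA : A.IsInvertible) (H : E →L[ℝ] E) :
    fderiv ℝ logDet A H = traceCLM (A.inverse.comp H) := by
  have hd : DifferentiableAt ℝ logDet A :=
    (contDiffAt_logDet (k := 1) hA).differentiableAt one_ne_zero
  have h0 : HasDerivAt (fun t : ℝ => A + t • H) H 0 := by
    simpa using ((hasDerivAt_id (0 : ℝ)).smul_const H).const_add A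
  have h1 : HasDerivAt (fun t : ℝ => logDet (A + t • H)) (fderiv ℝ logDet A H) 0 := by
    have hd' : HasFDerivAt logDet (fderiv ℝ logDet A) (A + (0 : ℝ) • H) := by
      simpa using hd.hasFDerivAt
    exact hd'.comp_hasDerivAt (0 : ℝ) h0
  have h2 : (fun t : ℝ => logDet (A + t • H)) = fun t : ℝ =>
      Real.log (A.det * (ContinuousLinearMap.id ℝ E + t • A.inverse.comp H).det) := by
    funext t
    rw [logDet, ← det_comp]
    congr 2
    ext v
    have := congrArg (fun T : E →L[ℝ] E => T (H v)) hA.self_comp_inverse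
    simp only [ContinuousLinearMap.comp_apply, ContinuousLinearMap.id_apply] at this
    simp [this]
  have h3 : HasDerivAt (fun t : ℝ => logDet (A + t • H)) (traceCLM (A.inverse.comp H)) 0 := by
    rw [h2]
    have := ((hasDerivAt_det_one_add_smul (A.inverse.comp H)).const_mul A.det).log
      (by simpa [ContinuousLinearMap.det] using det_ne_zero_iff.2 hA)
    have hne := det_ne_zero_iff.2 hA
    convert this using 1
    have : (ContinuousLinearMap.id ℝ E + (0 : ℝ) • A.inverse.comp H).det = 1 := by
      simp [ContinuousLinearMap.det]
    rw [this]
    field_simp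
  exact h1.unique h3

theorem fderiv_logDet_comp {W : Type*} [NormedAddCommGroup W] [NormedSpace ℝ W]
    {A : W → E →L[ℝ] E} {y : W} (hA : (A y).IsInvertible) (hd : DifferentiableAt ℝ A y) (v : W) :
    fderiv ℝ (fun z => logDet (A z)) y v = traceCLM ((A y).inverse.comp (fderiv ℝ A y v)) := by
  have h := fderiv_comp y ((contDiffAt_logDet (k := 1) hA).differentiableAt one_ne_zero) hd
  rw [Function.comp_def] at h
  rw [h, ContinuousLinearMap.comp_apply, fderiv_logDet hA]

theorem eventually_isInvertible {W : Type*} [TopologicalSpace W] {A : W → E →L[ℝ] E} {y : W}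
    (hA : (A y).IsInvertible) (hc : ContinuousAt A y) : ∀ᶠ z in 𝓝 y, (A z).IsInvertible := by
  have h : ContinuousAt (fun z => (A z).det) y :=
    ((contDiff_det (k := 0)).continuous.continuousAt).comp hc
  filter_upwards [h.eventually_ne (det_ne_zero_iff.2 hA)] with z hz using det_ne_zero_iff.1 hz

end LogDet

/-! ### Connections of the form S⁻¹dS and the trace of their curvature -/

section Frame

variable {E : Type*} [NormedAddCommGroup E] [NormedSpace ℝ E]
  {V : Type*} [NormedAddCommGroup V] [NormedSpace ℝ V]

/-- The connection form `S⁻¹ dS` of a field `S` of invertible endomorphisms, restricted to the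
directions in the image of `ι`. -/
def frameConnection (S : V → E →L[ℝ] E) (ι : E →L[ℝ] V) (z : V) : E →L[ℝ] E →L[ℝ] E :=
  (ContinuousLinearMap.compL ℝ E E E (S z).inverse).comp ((fderiv ℝ S z).comp ι)

variable {S : V → E →L[ℝ] E} {ι : E →L[ℝ] V} {y : V}

theorem frameConnection_apply (z : V) (a : E) :
    frameConnection S ι z a = (S z).inverse.comp (fderiv ℝ S z (ι a)) := rfl

theorem apply_frameConnection {z : V} (hS : (S z).IsInvertible) (a b : E) :
    S z (frameConnection S ι z a b) = fderiv ℝ S z (ι a) b :=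
  congrArg (fun T : E →L[ℝ] E => T (fderiv ℝ S z (ι a) b)) hS.self_comp_inverse

theorem fderiv_clm_apply₂ {F G H : Type*} [NormedAddCommGroup F] [NormedSpace ℝ F]
    [NormedAddCommGroup G] [NormedSpace ℝ G] [NormedAddCommGroup H] [NormedSpace ℝ H]
    {A : V → F →L[ℝ] G →L[ℝ] H} (hA : DifferentiableAt ℝ A y) (a : F) (b : G) (u : V) :
    fderiv ℝ (fun z => A z a b) y u = fderiv ℝ A y u a b := by
  rw [fderiv_clm_apply (hA.clm_apply (differentiableAt_const a)) (differentiableAt_const b)]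
  rw [fderiv_clm_apply hA (differentiableAt_const a)]
  simp

theorem contDiffAt_clm_flip {F G H : Type*} [NormedAddCommGroup F] [NormedSpace ℝ F]
    [NormedAddCommGroup G] [NormedSpace ℝ G] [NormedAddCommGroup H] [NormedSpace ℝ H]
    {k : WithTop ℕ∞} {A : V → F →L[ℝ] G →L[ℝ] H} (hA : ContDiffAt ℝ k A y) :
    ContDiffAt ℝ k (fun z => (A z).flip) y :=
  ContDiffAt.comp y (IsBoundedLinearMap.contDiff (𝕜 := ℝ) (n := k)
    (f := fun B : F →L[ℝ] G →L[ℝ] H => B.flip)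
    ⟨⟨fun _ _ => rfl, fun _ _ => rfl⟩, 1, one_pos, fun B => by simp⟩).contDiffAt hA

theorem fderiv_clm_apply₁ {F G : Type*} [NormedAddCommGroup F] [NormedSpace ℝ F]
    [NormedAddCommGroup G] [NormedSpace ℝ G]
    {A : V → F →L[ℝ] G} (hA : DifferentiableAt ℝ A y) (a : F) (u : V) :
    fderiv ℝ (fun z => A z a) y u = fderiv ℝ A y u a := by
  rw [fderiv_clm_apply hA (differentiableAt_const a)]
  simp

variable [FiniteDimensional ℝ E]

theorem contDiffAt_frameConnection (hS : (S y).IsInvertible) (hd : ContDiffAt ℝ 2 S y) :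
    ContDiffAt ℝ 1 (frameConnection S ι) y := by
  have h1 : ContDiffAt ℝ 1 (fun z => (S z).inverse) y :=
    ContDiffAt.comp y hS.contDiffAt_map_inverse (hd.of_le (by norm_num))
  have h2 : ContDiffAt ℝ 1 (fderiv ℝ S) y := hd.fderiv_right (by norm_num)
  exact ((ContinuousLinearMap.compL ℝ E E E).contDiff.contDiffAt.comp y h1).clm_comp
    (h2.clm_comp contDiffAt_const)

theorem eventually_frame (hS : (S y).IsInvertible) (hd : ContDiffAt ℝ 2 S y) :
    ∀ᶠ z in 𝓝 y, (S z).IsInvertible ∧ ContDiffAt ℝ 2 S z :=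
  (eventually_isInvertible hS hd.continuousAt).and (hd.eventually (by simp))

/-- Write Γ = S⁻¹dS. Differentiating SΓ_v = ∂_v S along a gives S(∂_aΓ_v + Γ_aΓ_v) = ∂_a∂_v S, which
is symmetric in a and v. Injectivity of S then removes the factor S. -/
theorem frameConnection_flat (hS : (S y).IsInvertible) (hd : ContDiffAt ℝ 2 S y) (a v w : E) :
    fderiv ℝ (frameConnection S ι) y (ι a) v w
        + frameConnection S ι y a (frameConnection S ι y v w) =
      fderiv ℝ (frameConnection S ι) y (ι v) a w
        + frameConnection S ι y v (frameConnection S ι y a w) := by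
  have hg := (contDiffAt_frameConnection (ι := ι) hS hd).differentiableAt one_ne_zero
  have hS1 := hd.differentiableAt two_ne_zero
  have hS2 : DifferentiableAt ℝ (fderiv ℝ S) y :=
    (hd.fderiv_right (m := 1) (by norm_num)).differentiableAt one_ne_zero
  have key : ∀ a v : E, S y (fderiv ℝ (frameConnection S ι) y (ι a) v w
      + frameConnection S ι y a (frameConnection S ι y v w)) =
      fderiv ℝ (fderiv ℝ S) y (ι a) (ι v) w := by
    intro a v
    have h1 : (fun z => S z (frameConnection S ι z v w)) =ᶠ[𝓝 y] fun z => fderiv ℝ S z (ι v) w := by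
      filter_upwards [eventually_frame hS hd] with z hz using apply_frameConnection hz.1 v w
    have h2 := congrArg (fun T : V →L[ℝ] E => T (ι a)) h1.fderiv_eq
    rw [fderiv_clm_apply hS1 ((hg.clm_apply (differentiableAt_const v)).clm_apply
      (differentiableAt_const w))] at h2
    simp only [add_apply, ContinuousLinearMap.comp_apply,
      ContinuousLinearMap.flip_apply] at h2
    rw [fderiv_clm_apply₂ hg, fderiv_clm_apply₂ hS2] at h2
    rw [map_add, apply_frameConnection hS, h2]
  have hinj : Function.Injective (S y) := by
    obtain ⟨e, he⟩ := hS
    rw [← he]; exact e.injective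
  apply hinj
  rw [key, key, (hd.isSymmSndFDerivAt (by simp)).eq]

theorem traceCLM_frameConnection {z : V} (hS : (S z).IsInvertible) (hd : DifferentiableAt ℝ S z)
    (a : E) : traceCLM (frameConnection S ι z a) = fderiv ℝ (fun z => logDet (S z)) z (ι a) := by
  rw [fderiv_logDet_comp hS hd, frameConnection_apply]

theorem traceCLM_fderiv_frameConnection (hS : (S y).IsInvertible) (hd : ContDiffAt ℝ 2 S y)
    (u : V) (a : E) :
    traceCLM (fderiv ℝ (frameConnection S ι) y u a) =
      fderiv ℝ (fderiv ℝ fun z => logDet (S z)) y u (ι a) := by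
  have hg := (contDiffAt_frameConnection (ι := ι) hS hd).differentiableAt one_ne_zero
  have hl : ContDiffAt ℝ 2 (fun z => logDet (S z)) y := (contDiffAt_logDet hS).comp y hd
  have h1 : (fun z => traceCLM (frameConnection S ι z a)) =ᶠ[𝓝 y]
      fun z => fderiv ℝ (fun z => logDet (S z)) z (ι a) := by
    filter_upwards [eventually_frame hS hd] with z hz
    exact traceCLM_frameConnection hz.1 (hz.2.differentiableAt two_ne_zero) a
  have h2 := congrArg (fun T : V →L[ℝ] ℝ => T u) h1.fderiv_eq
  beta_reduce at h2
  rw [fderiv_clm_apply₁ ((hl.fderiv_right (m := 1) (by norm_num)).differentiableAt one_ne_zero)]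
    at h2
  rw [← h2]
  have h3 := (traceCLM (E := E)).hasFDerivAt.comp y
    (hg.clm_apply (differentiableAt_const a)).hasFDerivAt
  rw [Function.comp_def] at h3
  rw [h3.fderiv, ContinuousLinearMap.comp_apply, fderiv_clm_apply₁ hg]

/-- The torsion-free identity holds on a neighbourhood, so it may be differentiated in every
direction u, including those outside the image of `ι`. -/
theorem fderiv_frameConnection_symm (hS : (S y).IsInvertible) (hd : ContDiffAt ℝ 2 S y)
    (hsymm : ∀ᶠ z in 𝓝 y, ∀ a b : E, fderiv ℝ S z (ι a) b = fderiv ℝ S z (ι b) a)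
    (u : V) (a b : E) :
    fderiv ℝ (frameConnection S ι) y u a b = fderiv ℝ (frameConnection S ι) y u b a := by
  have hg := (contDiffAt_frameConnection (ι := ι) hS hd).differentiableAt one_ne_zero
  rw [← fderiv_clm_apply₂ hg, ← fderiv_clm_apply₂ hg]
  have h1 : (fun z => frameConnection S ι z a b) =ᶠ[𝓝 y] fun z => frameConnection S ι z b a := by
    filter_upwards [hsymm] with z hz
    simp only [frameConnection_apply, ContinuousLinearMap.comp_apply, hz a b]
  rw [h1.fderiv_eq]

/-- The trace of the curvature of the torsion-free connection `S⁻¹ dS`, when `S` also depends on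
parameters: only the derivative in the direction `q` of the parameters contributes. -/
theorem trace_curvature_frameConnection (hS : (S y).IsInvertible) (hd : ContDiffAt ℝ 2 S y)
    (hsymm : ∀ᶠ z in 𝓝 y, ∀ a b : E, fderiv ℝ S z (ι a) b = fderiv ℝ S z (ι b) a)
    (v w : E) (q : V) (R : E →ₗ[ℝ] E)
    (hR : ∀ a, R a = fderiv ℝ (frameConnection S ι) y (ι a) v w
      - fderiv ℝ (frameConnection S ι) y (ι v + q) a w
      + frameConnection S ι y a (frameConnection S ι y v w)
      - frameConnection S ι y v (frameConnection S ι y a w)) :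
    LinearMap.trace ℝ E R = -fderiv ℝ (fderiv ℝ fun z => logDet (S z)) y q (ι w) := by
  -- Flatness cancels everything except -(∂_qΓ)(a) w. Torsion-freeness rewrites this as -(∂_qΓ)(w)
  -- a, an endomorphism applied to a, whose trace comes from Jacobi's formula.
  have h : R = ((-fderiv ℝ (frameConnection S ι) y q w : E →L[ℝ] E) : E →ₗ[ℝ] E) := by
    ext a
    rw [hR]
    have h1 := frameConnection_flat (ι := ι) hS hd a v w
    have h2 := fderiv_frameConnection_symm hS hd hsymm q a w
    simp only [map_add, add_apply, ContinuousLinearMap.coe_coe,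
      neg_apply]
    rw [h2, ← sub_eq_zero]
    rw [← sub_eq_zero] at h1
    rw [← h1]
    abel
  rw [h, ← traceCLM_apply, map_neg, traceCLM_fderiv_frameConnection hS hd]

theorem trace_eq_trace_add_trace {F : Type*} [AddCommGroup F] [Module ℝ F]
    [FiniteDimensional ℝ F] (R : E × F →ₗ[ℝ] E × F) :
    LinearMap.trace ℝ (E × F) R =
      LinearMap.trace ℝ E (LinearMap.fst ℝ E F ∘ₗ R ∘ₗ LinearMap.inl ℝ E F) +
      LinearMap.trace ℝ F (LinearMap.snd ℝ E F ∘ₗ R ∘ₗ LinearMap.inr ℝ E F) := by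
  have h : R = LinearMap.inl ℝ E F ∘ₗ (LinearMap.fst ℝ E F ∘ₗ R) +
      LinearMap.inr ℝ E F ∘ₗ (LinearMap.snd ℝ E F ∘ₗ R) := by
    ext x <;> simp
  conv_lhs => rw [h]
  rw [map_add, LinearMap.trace_comp_comm' _ (LinearMap.inl ℝ E F),
    LinearMap.trace_comp_comm' _ (LinearMap.inr ℝ E F)]
  rfl

end Frame

/-! ### Kim–McCann metrics in product coordinates: regularity, nondegeneracy, Christoffel symbols -/

section LocalStructure

/-- The model space of an `n`-manifold. -/
abbrev Model (n : ℕ) := EuclideanSpace ℝ (Fin n)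

variable {n : ℕ}

/-- A field of bilinear forms on a product of two vector spaces which, near `y`, is given by the
mixed second derivatives of a cost function of class `C⁴`, and is nondegenerate at `y`. -/
structure IsKimMcCannAt (G : Model n × Model n → Model n × Model n →L[ℝ] Model n × Model n →L[ℝ] ℝ)
    (y : Model n × Model n) : Prop where
  exists_cost : ∃ c : Model n × Model n → ℝ, ContDiffAt ℝ 4 c y ∧ ∀ᶠ z in 𝓝 y, ∀ u v, G z u v =
    -(1 / 2) * (fderiv ℝ (fderiv ℝ c) z (u.1, 0) (0, v.2)
      + fderiv ℝ (fderiv ℝ c) z (v.1, 0) (0, u.2))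
  nondegenerate : ∀ u, (∀ v, G y u v = 0) → u = 0

variable (n) in
/-- The Riesz isomorphism of a real inner product space, from the dual to the space. -/
def rieszSharp : (Model n →L[ℝ] ℝ) →L[ℝ] Model n :=
  LinearMap.toContinuousLinearMap
    { toFun := (InnerProductSpace.toDual ℝ (Model n)).symm
      map_add' := fun a b => by simp
      map_smul' := fun a b => by simp }

theorem inner_rieszSharp (φ : Model n →L[ℝ] ℝ) (w : Model n) : ⟪rieszSharp n φ, w⟫_ℝ = φ w :=
  InnerProductSpace.toDual_symm_apply

/-- The endomorphism which represents the bilinear form `(v, w) ↦ G(ι v, κ w)`. -/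
def mixedEnd (G : Model n × Model n → Model n × Model n →L[ℝ] Model n × Model n →L[ℝ] ℝ)
    (ι κ : Model n →L[ℝ] Model n × Model n) (z : Model n × Model n) :
    Model n →L[ℝ] Model n :=
  ((rieszSharp n).comp ((ContinuousLinearMap.compL ℝ (Model n) (Model n × Model n) ℝ).flip κ)).comp
    ((G z).comp ι)

variable {G : Model n × Model n → Model n × Model n →L[ℝ] Model n × Model n →L[ℝ] ℝ}
  {y : Model n × Model n} {ι κ : Model n →L[ℝ] Model n × Model n}

theorem inner_mixedEnd (z : Model n × Model n) (v w : Model n) :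
    ⟪mixedEnd G ι κ z v, w⟫_ℝ = G z (ι v) (κ w) := by
  simp [mixedEnd, inner_rieszSharp]

theorem contDiffAt_mixedEnd {k : WithTop ℕ∞} (hG : ContDiffAt ℝ k G y) :
    ContDiffAt ℝ k (mixedEnd G ι κ) y :=
  contDiffAt_const.clm_comp (hG.clm_comp contDiffAt_const)

theorem inner_fderiv_mixedEnd (hG : DifferentiableAt ℝ G y)
    (u : Model n × Model n) (v w : Model n) :
    ⟪fderiv ℝ (mixedEnd G ι κ) y u v, w⟫_ℝ = fderiv ℝ G y u (ι v) (κ w) := by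
  have hm : DifferentiableAt ℝ (mixedEnd G ι κ) y :=
    (differentiableAt_const _).clm_comp (hG.clm_comp (differentiableAt_const _))
  have h : fderiv ℝ (fun z => ⟪mixedEnd G ι κ z v, w⟫_ℝ) y u =
      ⟪fderiv ℝ (mixedEnd G ι κ) y u v, w⟫_ℝ := by
    rw [fderiv_inner_apply ℝ (hm.clm_apply (differentiableAt_const v)) (differentiableAt_const w),
      fderiv_clm_apply₁ hm]
    simp
  simp_rw [inner_mixedEnd] at h
  rw [← h, fderiv_clm_apply₂ hG]

/-- Both sides, paired with w, are -1/2 times a third derivative of c in the directions `ι a`, `ι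
b`, `κ w`, and third derivatives are symmetric. -/
theorem fderiv_mixedEnd_symm {c : Model n × Model n → ℝ} (hc : ContDiffAt ℝ 4 c y)
    (hG : DifferentiableAt ℝ G y)
    (h : ∀ᶠ z in 𝓝 y, ∀ v w : Model n, G z (ι v) (κ w) =
      -(1 / 2) * fderiv ℝ (fderiv ℝ c) z (ι v) (κ w)) (a b : Model n) :
    fderiv ℝ (mixedEnd G ι κ) y (ι a) b = fderiv ℝ (mixedEnd G ι κ) y (ι b) a := by
  have h1 : ContDiffAt ℝ 3 (fderiv ℝ c) y := hc.fderiv_right (by norm_num)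
  have h2 : DifferentiableAt ℝ (fderiv ℝ (fderiv ℝ c)) y :=
    (h1.fderiv_right (m := 2) (by norm_num)).differentiableAt two_ne_zero
  have key : ∀ a b w : Model n, fderiv ℝ G y (ι a) (ι b) (κ w) =
      -(1 / 2) * fderiv ℝ (fderiv ℝ (fderiv ℝ c)) y (ι a) (ι b) (κ w) := by
    intro a b w
    rw [← fderiv_clm_apply₂ hG, ← fderiv_clm_apply₂ h2]
    have h3 : (fun z => G z (ι b) (κ w)) =ᶠ[𝓝 y] fun z =>
        -(1 / 2) * fderiv ℝ (fderiv ℝ c) z (ι b) (κ w) := by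
      filter_upwards [h] with z hz using hz b w
    rw [h3.fderiv_eq, fderiv_const_mul]
    · rfl
    · exact (h2.clm_apply (differentiableAt_const _)).clm_apply (differentiableAt_const _)
  refine ext_inner_right ℝ fun w => ?_
  have h3 : IsSymmSndFDerivAt ℝ (fderiv ℝ c) y :=
    (h1.of_le (by norm_num : (2 : WithTop ℕ∞) ≤ 3)).isSymmSndFDerivAt (by simp)
  rw [inner_fderiv_mixedEnd hG, inner_fderiv_mixedEnd hG, key, key, h3.eq]

variable (n) in
/-- Inclusion of the first factor. -/
abbrev inL : Model n →L[ℝ] Model n × Model n := ContinuousLinearMap.inl ℝ (Model n) (Model n)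

variable (n) in
/-- Inclusion of the second factor. -/
abbrev inR : Model n →L[ℝ] Model n × Model n := ContinuousLinearMap.inr ℝ (Model n) (Model n)

namespace IsKimMcCannAt

theorem contDiffAt (hG : IsKimMcCannAt G y) : ContDiffAt ℝ 2 G y := by
  obtain ⟨c, hc, h⟩ := hG.exists_cost
  have hD : ContDiffAt ℝ 2 (fderiv ℝ (fderiv ℝ c)) y :=
    (hc.fderiv_right (m := 3) (by norm_num)).fderiv_right (m := 2) (by norm_num)
  -- B carries the block pairing u.1 with v.2; its flip carries the other block.
  set B : Model n × Model n → Model n × Model n →L[ℝ] Model n × Model n →L[ℝ] ℝ := fun z =>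
    ((ContinuousLinearMap.compL ℝ (Model n × Model n) (Model n × Model n) ℝ).flip
      ((inR n).comp (ContinuousLinearMap.snd ℝ (Model n) (Model n)))).comp
      ((fderiv ℝ (fderiv ℝ c) z).comp ((-(1 / 2) : ℝ) •
        (inL n).comp (ContinuousLinearMap.fst ℝ (Model n) (Model n)))) with hB
  have hBd : ContDiffAt ℝ 2 B y := contDiffAt_const.clm_comp (hD.clm_comp contDiffAt_const)
  have hF : ContDiffAt ℝ 2 (fun z => (B z).flip) y := contDiffAt_clm_flip hBd
  refine (hBd.add hF).congr_of_eventuallyEq ?_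
  filter_upwards [h] with z hz
  refine ContinuousLinearMap.ext fun u => ContinuousLinearMap.ext fun v => ?_
  rw [hz]
  simp [hB]
  ring

theorem eventually_apply (hG : IsKimMcCannAt G y) : ∀ᶠ z in 𝓝 y, ∀ u v, G z u v =
    ⟪mixedEnd G (inL n) (inR n) z u.1, v.2⟫_ℝ + ⟪mixedEnd G (inL n) (inR n) z v.1, u.2⟫_ℝ := by
  obtain ⟨c, -, h⟩ := hG.exists_cost
  filter_upwards [h] with z hz u v
  rw [inner_mixedEnd, inner_mixedEnd, hz, hz, hz]
  have h0 : ((0 : Model n), (0 : Model n)) = 0 := rfl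
  simp [h0]
  ring

theorem apply (hG : IsKimMcCannAt G y) (u v : Model n × Model n) : G y u v =
    ⟪mixedEnd G (inL n) (inR n) y u.1, v.2⟫_ℝ + ⟪mixedEnd G (inL n) (inR n) y v.1, u.2⟫_ℝ :=
  hG.eventually_apply.self_of_nhds u v

/-- The two mixed endomorphisms are adjoint, so the second factor can be treated by the same frame
calculus with S* in place of S. -/
theorem inner_left_eq_inner_right (hG : IsKimMcCannAt G y) (v w : Model n) :
    ⟪mixedEnd G (inL n) (inR n) y v, w⟫_ℝ = ⟪v, mixedEnd G (inR n) (inL n) y w⟫_ℝ := by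
  rw [real_inner_comm _ v, inner_mixedEnd _ w v, hG.apply]
  simp

theorem isInvertible_of_injective {A : Model n →L[ℝ] Model n} (h : ∀ v, A v = 0 → v = 0) :
    A.IsInvertible :=
  ⟨(LinearEquiv.ofInjectiveEndo (A : Model n →ₗ[ℝ] Model n)
    ((injective_iff_map_eq_zero (A : Model n →ₗ[ℝ] Model n)).2 h)).toContinuousLinearEquiv,
    by ext; rfl⟩

theorem isInvertible_left (hG : IsKimMcCannAt G y) :
    (mixedEnd G (inL n) (inR n) y).IsInvertible := by
  refine isInvertible_of_injective fun v hv => ?_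
  have := hG.nondegenerate (v, 0) fun w => by rw [hG.apply]; simp [hv]
  simpa using this

theorem isInvertible_right (hG : IsKimMcCannAt G y) :
    (mixedEnd G (inR n) (inL n) y).IsInvertible := by
  refine isInvertible_of_injective fun w hw => ?_
  have := hG.nondegenerate (0, w) fun v => by
    rw [hG.apply, hG.inner_left_eq_inner_right, hG.inner_left_eq_inner_right]; simp [hw]
  simpa using this

/-- Nondegeneracy amounts to invertibility of S, which is an open condition. -/
theorem eventually (hG : IsKimMcCannAt G y) : ∀ᶠ z in 𝓝 y, IsKimMcCannAt G z := by
  have h0 := hG.eventually_apply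
  obtain ⟨c, hc, h⟩ := hG.exists_cost
  filter_upwards [hc.eventually (by simp), h.eventually_nhds, h0,
    eventually_isInvertible hG.isInvertible_left
      (contDiffAt_mixedEnd (k := 2) hG.contDiffAt).continuousAt]
    with z h1 h2 h3 h4
  refine ⟨⟨c, h1, h2⟩, fun u hu => ?_⟩
  obtain ⟨e, he⟩ := h4
  rw [← he] at h3
  refine Prod.ext ?_ ?_
  · have h5 : e u.1 = 0 := ext_inner_right ℝ fun w => by
      simpa [h3] using hu (0, w)
    simpa using h5
  · refine ext_inner_left ℝ fun w => ?_
    simpa [h3] using hu (e.symm w, 0)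

theorem isInvertible (hG : IsKimMcCannAt G y) : (G y).IsInvertible := by
  have h : Function.Injective (G y : Model n × Model n →ₗ[ℝ] Model n × Model n →L[ℝ] ℝ) :=
    (injective_iff_map_eq_zero _).2 fun u hu => hG.nondegenerate u fun v => by
      change (G y : Model n × Model n →ₗ[ℝ] Model n × Model n →L[ℝ] ℝ) u v = 0
      rw [hu]; rfl
  have hfin : Module.finrank ℝ (Model n × Model n) =
      Module.finrank ℝ (Model n × Model n →L[ℝ] ℝ) := by
    rw [← LinearEquiv.finrank_eq (LinearMap.toContinuousLinearMap
      (𝕜 := ℝ) (E := Model n × Model n) (F' := ℝ)), Subspace.dual_finrank_eq]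
  exact ⟨(LinearMap.linearEquivOfInjective _ h hfin).toContinuousLinearEquiv,
    ContinuousLinearMap.ext fun _ => rfl⟩

theorem eventually_symm_left (hG : IsKimMcCannAt G y) : ∀ᶠ z in 𝓝 y, ∀ a b : Model n,
    fderiv ℝ (mixedEnd G (inL n) (inR n)) z (inL n a) b =
      fderiv ℝ (mixedEnd G (inL n) (inR n)) z (inL n b) a := by
  filter_upwards [hG.eventually] with z hz a b
  obtain ⟨c, hc, h⟩ := hz.exists_cost
  refine fderiv_mixedEnd_symm hc (hz.contDiffAt.differentiableAt two_ne_zero) ?_ a b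
  filter_upwards [h] with z' h' v w
  have h0 : ((0 : Model n), (0 : Model n)) = 0 := rfl
  rw [h']; simp [h0]

theorem eventually_symm_right (hG : IsKimMcCannAt G y) : ∀ᶠ z in 𝓝 y, ∀ a b : Model n,
    fderiv ℝ (mixedEnd G (inR n) (inL n)) z (inR n a) b =
      fderiv ℝ (mixedEnd G (inR n) (inL n)) z (inR n b) a := by
  filter_upwards [hG.eventually] with z hz a b
  obtain ⟨c, hc, h⟩ := hz.exists_cost
  refine fderiv_mixedEnd_symm hc (hz.contDiffAt.differentiableAt two_ne_zero) ?_ a b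
  filter_upwards [h, hc.eventually (by simp)] with z' h' hc' v w
  have h0 : ((0 : Model n), (0 : Model n)) = 0 := rfl
  -- The cost hypothesis differentiates in the order first factor, second factor; here the opposite
  -- order is needed.
  have hs : IsSymmSndFDerivAt ℝ c z' :=
    (hc'.of_le (by norm_num : (2 : WithTop ℕ∞) ≤ 4)).isSymmSndFDerivAt (by simp)
  rw [h']; simp [h0, hs.eq (w, 0) (0, v)]

theorem fderiv_apply (hG : IsKimMcCannAt G y) (u v w : Model n × Model n) : fderiv ℝ G y u v w =
    ⟪fderiv ℝ (mixedEnd G (inL n) (inR n)) y u v.1, w.2⟫_ℝ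
      + ⟪fderiv ℝ (mixedEnd G (inL n) (inR n)) y u w.1, v.2⟫_ℝ := by
  have hd := hG.contDiffAt.differentiableAt two_ne_zero
  rw [inner_fderiv_mixedEnd hd, inner_fderiv_mixedEnd hd, ← fderiv_clm_apply₂ hd,
    ← fderiv_clm_apply₂ hd, ← fderiv_clm_apply₂ hd]
  have h : (fun z => G z v w) =ᶠ[𝓝 y] fun z =>
      G z (inL n v.1) (inR n w.2) + G z (inL n w.1) (inR n v.2) := by
    filter_upwards [hG.eventually_apply] with z hz
    rw [hz, inner_mixedEnd, inner_mixedEnd]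
  rw [h.fderiv_eq, fderiv_fun_add]
  · rfl
  · exact (hd.clm_apply (differentiableAt_const _)).clm_apply (differentiableAt_const _)
  · exact (hd.clm_apply (differentiableAt_const _)).clm_apply (differentiableAt_const _)

theorem inner_fderiv_left_eq (hG : IsKimMcCannAt G y) (u : Model n × Model n) (v w : Model n) :
    ⟪fderiv ℝ (mixedEnd G (inL n) (inR n)) y u v, w⟫_ℝ =
      ⟪v, fderiv ℝ (mixedEnd G (inR n) (inL n)) y u w⟫_ℝ := by
  have hd := hG.contDiffAt.differentiableAt two_ne_zero
  rw [real_inner_comm _ v, inner_fderiv_mixedEnd hd (ι := inR n), hG.fderiv_apply]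
  simp

/-- After pairing with w, each derivative of G splits along the two factors. The symmetries of dS
along the first factor (`hL`) and of dS* along the second (`hR`) cancel all mixed contributions. -/
theorem christoffel_eq (hG : IsKimMcCannAt G y) (u v : Model n × Model n) : christoffel G y u v =
    (frameConnection (mixedEnd G (inL n) (inR n)) (inL n) y u.1 v.1,
      frameConnection (mixedEnd G (inR n) (inL n)) (inR n) y u.2 v.2) := by
  rw [christoffel, hG.isInvertible.inverse_apply_eq]
  refine ContinuousLinearMap.ext fun w => ?_
  rw [hG.apply, apply_frameConnection hG.isInvertible_left, hG.inner_left_eq_inner_right w.1,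
    apply_frameConnection hG.isInvertible_right, ← hG.inner_fderiv_left_eq]
  have hsplit : ∀ u : Model n × Model n, u = inL n u.1 + inR n u.2 := fun u => by simp
  have hL := hG.eventually_symm_left.self_of_nhds
  have hR : ∀ a b v : Model n, ⟪fderiv ℝ (mixedEnd G (inL n) (inR n)) y (inR n a) v, b⟫_ℝ =
      ⟪fderiv ℝ (mixedEnd G (inL n) (inR n)) y (inR n b) v, a⟫_ℝ := fun a b v => by
    rw [hG.inner_fderiv_left_eq, hG.inner_fderiv_left_eq,
      hG.eventually_symm_right.self_of_nhds a b]
  simp only [christoffelFirst, smul_apply, add_apply, sub_apply, ContinuousLinearMap.flip_apply,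
    hG.fderiv_apply]
  have e : ∀ u v w : Model n × Model n, ⟪fderiv ℝ (mixedEnd G (inL n) (inR n)) y u v.1, w.2⟫_ℝ =
      ⟪fderiv ℝ (mixedEnd G (inL n) (inR n)) y (inL n u.1) v.1, w.2⟫_ℝ +
      ⟪fderiv ℝ (mixedEnd G (inL n) (inR n)) y (inR n u.2) v.1, w.2⟫_ℝ := fun u v w => by
    conv_lhs => rw [hsplit u]
    rw [map_add, add_apply, inner_add_left]
  rw [e u v w, e u w v, e v u w, e v w u, e w u v, e w v u, hL v.1 u.1, hL w.1 u.1, hL w.1 v.1,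
    hR w.2 v.2 u.1, hR w.2 u.2 v.1, hR v.2 u.2 w.1]
  simp only [smul_eq_mul]
  ring

end IsKimMcCannAt

end LocalStructure

/-! ### The Ricci tensor as mixed second derivatives of log|det S| -/

section LocalRicci

variable {n : ℕ} {G : Model n × Model n → Model n × Model n →L[ℝ] Model n × Model n →L[ℝ] ℝ}
  {y : Model n × Model n}

/-- The logarithm of the absolute value of the determinant of the mixed part of the metric. -/
def logDetMixed (G : Model n × Model n → Model n × Model n →L[ℝ] Model n × Model n →L[ℝ] ℝ)
    (z : Model n × Model n) : ℝ :=
  logDet (mixedEnd G (inL n) (inR n) z)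

/-- In an orthonormal basis the two matrices are transposes of each other. -/
theorem det_eq_of_inner_eq {A B : Model n →L[ℝ] Model n}
    (h : ∀ v w, ⟪A v, w⟫_ℝ = ⟪v, B w⟫_ℝ) : A.det = B.det := by
  set b := EuclideanSpace.basisFun (Fin n) ℝ
  rw [ContinuousLinearMap.det, ContinuousLinearMap.det, ← LinearMap.det_toMatrix b.toBasis,
    ← LinearMap.det_toMatrix b.toBasis, ← Matrix.det_transpose]
  congr 1
  ext i j
  simp only [Matrix.transpose_apply, LinearMap.toMatrix_apply, OrthonormalBasis.coe_toBasis,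
    OrthonormalBasis.coe_toBasis_repr_apply, OrthonormalBasis.repr_apply_apply,
    ContinuousLinearMap.coe_coe]
  rw [← h, real_inner_comm]

namespace IsKimMcCannAt

theorem contDiffAt_logDetMixed (hG : IsKimMcCannAt G y) : ContDiffAt ℝ 2 (logDetMixed G) y :=
  (contDiffAt_logDet hG.isInvertible_left).comp y (contDiffAt_mixedEnd hG.contDiffAt)

theorem eventually_logDet_right (hG : IsKimMcCannAt G y) :
    (fun z => logDet (mixedEnd G (inR n) (inL n) z)) =ᶠ[𝓝 y] logDetMixed G := by
  filter_upwards [hG.eventually] with z hz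
  rw [logDetMixed, logDet, logDet, det_eq_of_inner_eq hz.inner_left_eq_inner_right]

theorem fderiv_christoffel (hG : IsKimMcCannAt G y) (u v z : Model n × Model n) :
    fderiv ℝ (fun y' => christoffel G y' v z) y u =
      (fderiv ℝ (frameConnection (mixedEnd G (inL n) (inR n)) (inL n)) y u v.1 z.1,
        fderiv ℝ (frameConnection (mixedEnd G (inR n) (inL n)) (inR n)) y u v.2 z.2) := by
  have hg := (contDiffAt_frameConnection (ι := inL n) hG.isInvertible_left
    (contDiffAt_mixedEnd hG.contDiffAt)).differentiableAt one_ne_zero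
  have hg' := (contDiffAt_frameConnection (ι := inR n) hG.isInvertible_right
    (contDiffAt_mixedEnd hG.contDiffAt)).differentiableAt one_ne_zero
  have h : (fun y' => christoffel G y' v z) =ᶠ[𝓝 y] fun y' =>
      (frameConnection (mixedEnd G (inL n) (inR n)) (inL n) y' v.1 z.1,
        frameConnection (mixedEnd G (inR n) (inL n)) (inR n) y' v.2 z.2) := by
    filter_upwards [hG.eventually] with y' hy' using hy'.christoffel_eq v z
  rw [h.fderiv_eq, ← fderiv_clm_apply₂ hg, ← fderiv_clm_apply₂ hg', DifferentiableAt.fderiv_prodMk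
    ((hg.clm_apply (differentiableAt_const _)).clm_apply (differentiableAt_const _))
    ((hg'.clm_apply (differentiableAt_const _)).clm_apply (differentiableAt_const _))]
  rfl

theorem localRicci_eq (hG : IsKimMcCannAt G y) (v z : Model n × Model n) :
    localRicci G y v z =
      -fderiv ℝ (fderiv ℝ (logDetMixed G)) y (0, v.2) (z.1, 0)
        - fderiv ℝ (fderiv ℝ (logDetMixed G)) y (v.1, 0) (0, z.2) := by
  set g := frameConnection (mixedEnd G (inL n) (inR n)) (inL n) with hg
  set g' := frameConnection (mixedEnd G (inR n) (inL n)) (inR n) with hg'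
  have hcurv : ∀ u, curvature G y u v z =
      (fderiv ℝ g y u v.1 z.1 - fderiv ℝ g y v u.1 z.1 + g y u.1 (g y v.1 z.1)
        - g y v.1 (g y u.1 z.1),
      fderiv ℝ g' y u v.2 z.2 - fderiv ℝ g' y v u.2 z.2 + g' y u.2 (g' y v.2 z.2)
        - g' y v.2 (g' y u.2 z.2)) := fun u => by
    simp only [curvature, hG.fderiv_christoffel, hG.christoffel_eq]
    rfl
  let R : Model n × Model n →ₗ[ℝ] Model n × Model n :=
    { toFun := fun u => curvature G y u v z
      map_add' := fun a b => by
        simp only [hcurv, map_add, add_apply, Prod.fst_add, Prod.snd_add, Prod.mk_add_mk]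
        ext1 <;> simp only <;> abel
      map_smul' := fun a b => by
        simp only [hcurv, map_smul, smul_apply, Prod.smul_fst, Prod.smul_snd, Prod.smul_mk,
          RingHom.id_apply, smul_add, smul_sub] }
  have h1 : localRicci G y v z = LinearMap.trace ℝ _ R := by
    rw [LinearMap.trace_eq_matrix_trace ℝ (Module.finBasis ℝ (Model n × Model n))]
    simp [Matrix.trace, LinearMap.toMatrix_apply, localRicci, R]
  -- In the first block v.1 lies along the factor and (0, v.2) is the parameter direction; in the
  -- second block the roles are exchanged. Since det S* = det S, both traces are second derivatives
  -- of the same function.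
  rw [h1, trace_eq_trace_add_trace,
    trace_curvature_frameConnection hG.isInvertible_left (contDiffAt_mixedEnd hG.contDiffAt)
      hG.eventually_symm_left v.1 z.1 (0, v.2),
    trace_curvature_frameConnection hG.isInvertible_right (contDiffAt_mixedEnd hG.contDiffAt)
      hG.eventually_symm_right v.2 z.2 (v.1, 0),
    hG.eventually_logDet_right.fderiv.fderiv_eq]
  · rfl
  · intro a
    simp [R, hcurv, hg']
  · intro a
    simp [R, hcurv, hg]

end IsKimMcCannAt

end LocalRicci

/-! ### The mean curvature form of a Lagrangian parametrization -/

section LocalLagrangian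

variable {n : ℕ} {G : Model n × Model n → Model n × Model n →L[ℝ] Model n × Model n →L[ℝ] ℝ}
  {f : Model n → Model n × Model n} {x : Model n}

variable (n) in
/-- The para-complex structure of the product of two copies of the model space. -/
def modelK : Model n × Model n →L[ℝ] Model n × Model n :=
  (ContinuousLinearMap.id ℝ (Model n)).prodMap (-ContinuousLinearMap.id ℝ (Model n))

theorem modelK_apply (u : Model n × Model n) : modelK n u = (u.1, -u.2) := rfl

/-- `f` is near `x` a parametrized Lagrangian submanifold of class `C³` whose induced metric is
nondegenerate at `x`. -/
structure IsLagrangianAt (G : Model n × Model n → Model n × Model n →L[ℝ] Model n × Model n →L[ℝ] ℝ)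
    (f : Model n → Model n × Model n) (x : Model n) : Prop where
  isKimMcCannAt : IsKimMcCannAt G (f x)
  contDiffAt : ContDiffAt ℝ 3 f x
  lagrangian : ∀ᶠ z in 𝓝 x, ∀ a b, G (f z) (modelK n (fderiv ℝ f z a)) (fderiv ℝ f z b) = 0
  nondegenerate : ∀ a, (∀ b, G (f x) (fderiv ℝ f x a) (fderiv ℝ f x b) = 0) → a = 0

/-- The derivative of the first component of `f`. -/
def leftDeriv (f : Model n → Model n × Model n) (x : Model n) : Model n →L[ℝ] Model n :=
  (ContinuousLinearMap.fst ℝ (Model n) (Model n)).comp (fderiv ℝ f x)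

/-- The derivative of the second component of `f`. -/
def rightDeriv (f : Model n → Model n × Model n) (x : Model n) : Model n →L[ℝ] Model n :=
  (ContinuousLinearMap.snd ℝ (Model n) (Model n)).comp (fderiv ℝ f x)

/-- An expression of the mean curvature form of a Lagrangian submanifold through determinants. -/
def logDetForm (G : Model n × Model n → Model n × Model n →L[ℝ] Model n × Model n →L[ℝ] ℝ)
    (f : Model n → Model n × Model n) (x : Model n) : Model n →L[ℝ] ℝ :=
  (1 / 2 : ℝ) • (fderiv ℝ (fun z => logDet (leftDeriv f z) - logDet (rightDeriv f z)) x
    + (fderiv ℝ (logDetMixed G) (f x)).comp ((modelK n).comp (fderiv ℝ f x)))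

/-- The ambient covariant derivative `∇_a ∂_b f`. -/
def ambientDeriv (G : Model n × Model n → Model n × Model n →L[ℝ] Model n × Model n →L[ℝ] ℝ)
    (f : Model n → Model n × Model n) (x a b : Model n) : Model n × Model n :=
  fderiv ℝ (fderiv ℝ f) x a b + christoffel G (f x) (fderiv ℝ f x a) (fderiv ℝ f x b)

theorem IsKimMcCannAt.apply_modelK {y : Model n × Model n} (hG : IsKimMcCannAt G y)
    (u v : Model n × Model n) : G y (modelK n u) v =
      ⟪mixedEnd G (inL n) (inR n) y u.1, v.2⟫_ℝ - ⟪mixedEnd G (inL n) (inR n) y v.1, u.2⟫_ℝ := by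
  rw [hG.apply, modelK_apply, inner_neg_right, sub_eq_add_neg]

namespace IsLagrangianAt

theorem eventually (h : IsLagrangianAt G f x)
    (hnd : ∀ᶠ z in 𝓝 x, ∀ a, (∀ b, G (f z) (fderiv ℝ f z a) (fderiv ℝ f z b) = 0) → a = 0) :
    ∀ᶠ z in 𝓝 x, IsLagrangianAt G f z := by
  filter_upwards [h.contDiffAt.continuousAt.eventually h.isKimMcCannAt.eventually,
    h.contDiffAt.eventually (by simp), h.lagrangian.eventually_nhds, hnd] with z h1 h2 h3 h4
    using ⟨h1, h2, h3, h4⟩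

theorem contDiffAt_leftDeriv (h : IsLagrangianAt G f x) : ContDiffAt ℝ 2 (leftDeriv f) x :=
  contDiffAt_const.clm_comp (h.contDiffAt.fderiv_right (by norm_num))

theorem contDiffAt_rightDeriv (h : IsLagrangianAt G f x) : ContDiffAt ℝ 2 (rightDeriv f) x :=
  contDiffAt_const.clm_comp (h.contDiffAt.fderiv_right (by norm_num))

theorem differentiableAt_fderiv (h : IsLagrangianAt G f x) :
    DifferentiableAt ℝ (fderiv ℝ f) x :=
  (h.contDiffAt.fderiv_right (m := 2) (by norm_num)).differentiableAt two_ne_zero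

theorem fderiv_leftDeriv (h : IsLagrangianAt G f x) (a b : Model n) :
    fderiv ℝ (leftDeriv f) x a b = (fderiv ℝ (fderiv ℝ f) x a b).1 := by
  have hd : HasFDerivAt (leftDeriv f) _ x :=
    (hasFDerivAt_const (ContinuousLinearMap.fst ℝ (Model n) (Model n)) x).clm_comp
      h.differentiableAt_fderiv.hasFDerivAt
  rw [hd.fderiv]; simp

theorem fderiv_rightDeriv (h : IsLagrangianAt G f x) (a b : Model n) :
    fderiv ℝ (rightDeriv f) x a b = (fderiv ℝ (fderiv ℝ f) x a b).2 := by
  have hd : HasFDerivAt (rightDeriv f) _ x :=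
    (hasFDerivAt_const (ContinuousLinearMap.snd ℝ (Model n) (Model n)) x).clm_comp
      h.differentiableAt_fderiv.hasFDerivAt
  rw [hd.fderiv]; simp

theorem inner_symm (h : IsLagrangianAt G f x) (a b : Model n) :
    ⟪mixedEnd G (inL n) (inR n) (f x) (leftDeriv f x a), rightDeriv f x b⟫_ℝ =
      ⟪mixedEnd G (inL n) (inR n) (f x) (leftDeriv f x b), rightDeriv f x a⟫_ℝ := by
  have h1 := h.lagrangian.self_of_nhds a b
  rw [h.isKimMcCannAt.apply_modelK] at h1
  exact sub_eq_zero.1 h1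

theorem inducedMetric_eq (h : IsLagrangianAt G f x) (a b : Model n) :
    inducedMetric G f x a b =
      2 * ⟪mixedEnd G (inL n) (inR n) (f x) (leftDeriv f x a), rightDeriv f x b⟫_ℝ := by
  have h1 : inducedMetric G f x a b =
    ⟪mixedEnd G (inL n) (inR n) (f x) (leftDeriv f x a), rightDeriv f x b⟫_ℝ +
      ⟪mixedEnd G (inL n) (inR n) (f x) (leftDeriv f x b), rightDeriv f x a⟫_ℝ :=
    h.isKimMcCannAt.apply (fderiv ℝ f x a) (fderiv ℝ f x b)
  rw [h1, h.inner_symm b a, two_mul]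

theorem inducedMetric_nondegenerate (h : IsLagrangianAt G f x) (a : Model n)
    (ha : ∀ b, inducedMetric G f x a b = 0) : a = 0 :=
  h.nondegenerate a ha

/-- On a Lagrangian the induced metric is 2⟪S P a, Q b⟫, so the kernel of P lies in its radical. The
same argument works for Q. -/
theorem isInvertible_leftDeriv (h : IsLagrangianAt G f x) : (leftDeriv f x).IsInvertible := by
  refine IsKimMcCannAt.isInvertible_of_injective fun a ha => ?_
  refine h.inducedMetric_nondegenerate a fun b => ?_
  rw [h.inducedMetric_eq, ha]; simp

theorem isInvertible_rightDeriv (h : IsLagrangianAt G f x) : (rightDeriv f x).IsInvertible := by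
  refine IsKimMcCannAt.isInvertible_of_injective fun a ha => ?_
  refine h.inducedMetric_nondegenerate a fun b => ?_
  rw [h.inducedMetric_eq, h.inner_symm, ha]; simp

theorem ambientDeriv_fst (h : IsLagrangianAt G f x) (a b : Model n) :
    (ambientDeriv G f x a b).1 = fderiv ℝ (leftDeriv f) x a b +
      frameConnection (mixedEnd G (inL n) (inR n)) (inL n) (f x) (leftDeriv f x a)
        (leftDeriv f x b) := by
  rw [ambientDeriv, h.isKimMcCannAt.christoffel_eq, h.fderiv_leftDeriv]
  rfl

theorem ambientDeriv_snd (h : IsLagrangianAt G f x) (a b : Model n) :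
    (ambientDeriv G f x a b).2 = fderiv ℝ (rightDeriv f) x a b +
      frameConnection (mixedEnd G (inR n) (inL n)) (inR n) (f x) (rightDeriv f x a)
        (rightDeriv f x b) := by
  rw [ambientDeriv, h.isKimMcCannAt.christoffel_eq, h.fderiv_rightDeriv]
  rfl

theorem ambientDeriv_symm (h : IsLagrangianAt G f x) (a b : Model n) :
    ambientDeriv G f x a b = ambientDeriv G f x b a := by
  have hs : IsSymmSndFDerivAt ℝ f x :=
    (h.contDiffAt.of_le (by norm_num : (2 : WithTop ℕ∞) ≤ 3)).isSymmSndFDerivAt (by simp)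
  rw [ambientDeriv, ambientDeriv, hs.eq a b]
  congr 1
  simp only [christoffel, christoffelFirst]
  congr 2
  have hd := h.isKimMcCannAt.contDiffAt.differentiableAt two_ne_zero
  have e : ((fderiv ℝ G (f x)).flip (fderiv ℝ f x a)).flip (fderiv ℝ f x b) =
      ((fderiv ℝ G (f x)).flip (fderiv ℝ f x b)).flip (fderiv ℝ f x a) := by
    refine ContinuousLinearMap.ext fun u => ?_
    simp only [ContinuousLinearMap.flip_apply, h.isKimMcCannAt.fderiv_apply]
    ring
  rw [e, add_comm (fderiv ℝ G (f x) (fderiv ℝ f x a) (fderiv ℝ f x b))]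

theorem apply_modelK_ambientDeriv (h : IsLagrangianAt G f x) (a b v : Model n) :
    G (f x) (modelK n (ambientDeriv G f x a b)) (fderiv ℝ f x v) =
      ⟪mixedEnd G (inL n) (inR n) (f x) (fderiv ℝ (leftDeriv f) x a b), rightDeriv f x v⟫_ℝ
      + ⟪fderiv ℝ (mixedEnd G (inL n) (inR n)) (f x) (inL n (leftDeriv f x a)) (leftDeriv f x b),
          rightDeriv f x v⟫_ℝ
      - ⟪mixedEnd G (inL n) (inR n) (f x) (leftDeriv f x v), fderiv ℝ (rightDeriv f) x a b⟫_ℝ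
      - ⟪fderiv ℝ (mixedEnd G (inL n) (inR n)) (f x) (inR n (rightDeriv f x a)) (leftDeriv f x v),
          rightDeriv f x b⟫_ℝ := by
  have hG := h.isKimMcCannAt
  have e1 : (fderiv ℝ f x v).1 = leftDeriv f x v := rfl
  have e2 : (fderiv ℝ f x v).2 = rightDeriv f x v := rfl
  rw [hG.apply_modelK, h.ambientDeriv_fst, h.ambientDeriv_snd, e1, e2, map_add,
    apply_frameConnection hG.isInvertible_left, inner_add_left, inner_add_right,
    hG.inner_left_eq_inner_right _ (frameConnection _ _ _ _ _),
    apply_frameConnection hG.isInvertible_right, ← hG.inner_fderiv_left_eq]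
  ring

theorem fderiv_inner_mixedEnd (h : IsLagrangianAt G f x) (a b v : Model n) :
    fderiv ℝ (fun z => ⟪mixedEnd G (inL n) (inR n) (f z) (leftDeriv f z b), rightDeriv f z v⟫_ℝ)
      x a =
      ⟪fderiv ℝ (mixedEnd G (inL n) (inR n)) (f x) (fderiv ℝ f x a) (leftDeriv f x b),
        rightDeriv f x v⟫_ℝ
      + ⟪mixedEnd G (inL n) (inR n) (f x) (fderiv ℝ (leftDeriv f) x a b), rightDeriv f x v⟫_ℝ
      + ⟪mixedEnd G (inL n) (inR n) (f x) (leftDeriv f x b), fderiv ℝ (rightDeriv f) x a v⟫_ℝ := by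
  have hS : HasFDerivAt (fun z => mixedEnd G (inL n) (inR n) (f z)) _ x :=
    ((contDiffAt_mixedEnd h.isKimMcCannAt.contDiffAt).differentiableAt
      two_ne_zero).hasFDerivAt.comp x (h.contDiffAt.differentiableAt three_ne_zero).hasFDerivAt
  have hP := h.contDiffAt_leftDeriv.differentiableAt two_ne_zero
  have hQ := h.contDiffAt_rightDeriv.differentiableAt two_ne_zero
  have hPb := hP.clm_apply (differentiableAt_const b)
  have hQv := hQ.clm_apply (differentiableAt_const v)
  rw [fderiv_inner_apply ℝ (hS.differentiableAt.clm_apply hPb) hQv,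
    fderiv_clm_apply hS.differentiableAt hPb, fderiv_clm_apply₁ hQ, hS.fderiv]
  simp only [add_apply, ContinuousLinearMap.comp_apply, ContinuousLinearMap.flip_apply]
  rw [fderiv_clm_apply₁ hP, inner_add_left]
  ring

/-- This is the derivative along a of the Lagrangian identity ⟪S P b, Q v⟫ = ⟪S P v, Q b⟫, which
holds near x. Together with `ambientDeriv_symm` it makes the cubic form totally symmetric. -/
theorem apply_modelK_ambientDeriv_symm (h : IsLagrangianAt G f x)
    (hnd : ∀ᶠ z in 𝓝 x, ∀ a, (∀ b, G (f z) (fderiv ℝ f z a) (fderiv ℝ f z b) = 0) → a = 0)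
    (a b v : Model n) :
    G (f x) (modelK n (ambientDeriv G f x a b)) (fderiv ℝ f x v) =
      G (f x) (modelK n (ambientDeriv G f x a v)) (fderiv ℝ f x b) := by
  have hev : (fun z => ⟪mixedEnd G (inL n) (inR n) (f z) (leftDeriv f z b), rightDeriv f z v⟫_ℝ)
      =ᶠ[𝓝 x] fun z =>
        ⟪mixedEnd G (inL n) (inR n) (f z) (leftDeriv f z v), rightDeriv f z b⟫_ℝ := by
    filter_upwards [h.eventually hnd] with z hz using hz.inner_symm b v
  have h1 := h.fderiv_inner_mixedEnd a b v
  rw [hev.fderiv_eq, h.fderiv_inner_mixedEnd] at h1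
  have e : ∀ b v, ⟪fderiv ℝ (mixedEnd G (inL n) (inR n)) (f x) (fderiv ℝ f x a) (leftDeriv f x b),
      rightDeriv f x v⟫_ℝ =
      ⟪fderiv ℝ (mixedEnd G (inL n) (inR n)) (f x) (inL n (leftDeriv f x a)) (leftDeriv f x b),
        rightDeriv f x v⟫_ℝ +
      ⟪fderiv ℝ (mixedEnd G (inL n) (inR n)) (f x) (inR n (rightDeriv f x a)) (leftDeriv f x b),
        rightDeriv f x v⟫_ℝ := fun b v => by
    have : fderiv ℝ f x a = inL n (leftDeriv f x a) + inR n (rightDeriv f x a) := by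
      simp [leftDeriv, rightDeriv]
    rw [← inner_add_left, ← add_apply, ← map_add, ← this]
  rw [h.apply_modelK_ambientDeriv, h.apply_modelK_ambientDeriv]
  rw [e, e] at h1
  linarith

/-- K sends tangent vectors of a Lagrangian to normal ones, so the subtracted tangential part
contributes nothing. -/
theorem apply_modelK_normalPart (h : IsLagrangianAt G f x) (w : Model n × Model n) (v : Model n) :
    G (f x) (modelK n (normalPart G f x w)) (fderiv ℝ f x v) =
      G (f x) (modelK n w) (fderiv ℝ f x v) := by
  rw [normalPart, map_sub, map_sub, sub_apply, h.lagrangian.self_of_nhds, sub_zero]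

/-- The trace of `T` in terms of a nondegenerate symmetric bilinear form `g`. -/
theorem sum_inv_mul_eq_trace {g : Model n →L[ℝ] Model n →L[ℝ] ℝ} (hs : ∀ a b, g a b = g b a)
    (hnd : ∀ a, (∀ b, g a b = 0) → a = 0) (T : Model n →L[ℝ] Model n) :
    ∑ i, ∑ j, (Matrix.of fun i j => g (EuclideanSpace.basisFun (Fin n) ℝ i)
        (EuclideanSpace.basisFun (Fin n) ℝ j))⁻¹ i j *
      g (T (EuclideanSpace.basisFun (Fin n) ℝ i)) (EuclideanSpace.basisFun (Fin n) ℝ j) =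
      traceCLM T := by
  set b := EuclideanSpace.basisFun (Fin n) ℝ with hb
  set m : Matrix (Fin n) (Fin n) ℝ := Matrix.of fun i j => g (b i) (b j) with hm
  set t := LinearMap.toMatrix b.toBasis b.toBasis (T : Model n →ₗ[ℝ] Model n) with ht
  have hT : ∀ i, T (b i) = ∑ k, t k i • b k := fun i => by
    conv_lhs => rw [← b.toBasis.sum_repr (T (b i))]
    simp [ht, LinearMap.toMatrix_apply]
  -- A vector in the left kernel of the Gram matrix would give a vector in the radical of g.
  have hdet : IsUnit m.det := by
    rw [isUnit_iff_ne_zero]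
    intro h0
    obtain ⟨c, hc, hmc⟩ := Matrix.exists_vecMul_eq_zero_iff.2 h0
    apply hc
    have h1 : ∑ i, c i • b i = 0 := by
      refine hnd _ fun w => ?_
      rw [← b.toBasis.sum_repr w]
      simp only [map_sum, map_smul, sum_apply, smul_apply, smul_eq_mul,
        OrthonormalBasis.coe_toBasis]
      refine Finset.sum_eq_zero fun j _ => ?_
      have := congrFun hmc j
      simp only [Matrix.vecMul, dotProduct, hm, Matrix.of_apply, Pi.zero_apply] at this
      rw [this, mul_zero]
    funext i
    have h2 := b.toBasis.linearIndependent
    rw [Fintype.linearIndependent_iff] at h2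
    exact h2 c (by simpa using h1) i
  have hmt : m.transpose = m := by
    ext i j
    simp [hm, hs (b j) (b i)]
  have hmi : m⁻¹.transpose = m⁻¹ := by rw [Matrix.transpose_nonsing_inv, hmt]
  calc ∑ i, ∑ j, m⁻¹ i j * g (T (b i)) (b j)
      = ∑ i, ∑ j, ∑ k, m⁻¹ j i * (t k i * m k j) := by
        refine Finset.sum_congr rfl fun i _ => Finset.sum_congr rfl fun j _ => ?_
        rw [← Finset.mul_sum, hT i]
        conv_lhs => rw [← hmi]
        simp [hm, sum_apply]
    _ = (t * (m * m⁻¹).transpose).trace := by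
        simp only [Matrix.trace, Matrix.diag_apply, Matrix.mul_apply, Matrix.transpose_apply,
          Finset.mul_sum]
        conv_rhs => rw [Finset.sum_comm]
        refine Finset.sum_congr rfl fun i _ => ?_
        conv_rhs => rw [Finset.sum_comm]
        exact Finset.sum_congr rfl fun j _ => Finset.sum_congr rfl fun k _ => by ring
    _ = traceCLM T := by
        rw [Matrix.mul_nonsing_inv _ hdet, Matrix.transpose_one, mul_one, traceCLM_apply,
          LinearMap.trace_eq_matrix_trace ℝ b.toBasis]

theorem fderiv_logDetMixed_left {y : Model n × Model n} (hG : IsKimMcCannAt G y) (a : Model n) :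
    traceCLM (frameConnection (mixedEnd G (inL n) (inR n)) (inL n) y a) =
      fderiv ℝ (logDetMixed G) y (inL n a) :=
  traceCLM_frameConnection hG.isInvertible_left
    ((contDiffAt_mixedEnd hG.contDiffAt).differentiableAt two_ne_zero) a

theorem fderiv_logDetMixed_right {y : Model n × Model n} (hG : IsKimMcCannAt G y) (a : Model n) :
    traceCLM (frameConnection (mixedEnd G (inR n) (inL n)) (inR n) y a) =
      fderiv ℝ (logDetMixed G) y (inR n a) := by
  rw [← hG.eventually_logDet_right.fderiv_eq]
  exact traceCLM_frameConnection hG.isInvertible_right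
    ((contDiffAt_mixedEnd hG.contDiffAt).differentiableAt two_ne_zero) a

theorem traceCLM_conj {A : Model n →L[ℝ] Model n} (hA : A.IsInvertible)
    (B : Model n →L[ℝ] Model n) : traceCLM (A.inverse.comp (B.comp A)) = traceCLM B := by
  have h1 : traceCLM (A.inverse.comp (B.comp A)) = traceCLM ((B.comp A).comp A.inverse) :=
    LinearMap.trace_comp_comm' ((B.comp A : Model n →L[ℝ] Model n) : Model n →ₗ[ℝ] Model n)
      (A.inverse : Model n →ₗ[ℝ] Model n)
  rw [h1, ContinuousLinearMap.comp_assoc, hA.self_comp_inverse, ContinuousLinearMap.comp_id]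

theorem apply_localMeanCurvature (h : IsLagrangianAt G f x)
    (hnd : ∀ᶠ z in 𝓝 x, ∀ a, (∀ b, G (f z) (fderiv ℝ f z a) (fderiv ℝ f z b) = 0) → a = 0)
    (v : Model n) :
    G (f x) (modelK n (localMeanCurvature G f x)) (fderiv ℝ f x v) = logDetForm G f x v := by
  have hG := h.isKimMcCannAt
  have hP := h.isInvertible_leftDeriv
  have hQ := h.isInvertible_rightDeriv
  have hPd := h.contDiffAt_leftDeriv.differentiableAt two_ne_zero
  have hQd := h.contDiffAt_rightDeriv.differentiableAt two_ne_zero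
  set e := EuclideanSpace.basisFun (Fin n) ℝ with he
  set P := leftDeriv f x with hPx
  set Q := rightDeriv f x with hQx
  -- T₁ and T₂ are chosen so that ∇_v∂_a f = (P T₁ a, Q T₂ a).
  set T₁ : Model n →L[ℝ] Model n := P.inverse.comp (fderiv ℝ (leftDeriv f) x v +
    (frameConnection (mixedEnd G (inL n) (inR n)) (inL n) (f x) (P v)).comp P) with hT₁
  set T₂ : Model n →L[ℝ] Model n := Q.inverse.comp (fderiv ℝ (rightDeriv f) x v +
    (frameConnection (mixedEnd G (inR n) (inL n)) (inR n) (f x) (Q v)).comp Q) with hT₂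
  have hsym : ∀ a b, inducedMetric G f x a b = inducedMetric G f x b a := fun a b => by
    rw [h.inducedMetric_eq, h.inducedMetric_eq, h.inner_symm]
  have h₁ : ∀ a, (ambientDeriv G f x v a).1 = P (T₁ a) := fun a => by
    rw [h.ambientDeriv_fst]
    exact (congrArg (fun A : Model n →L[ℝ] Model n => A (_ : Model n)) hP.self_comp_inverse).symm
  have h₂ : ∀ a, (ambientDeriv G f x v a).2 = Q (T₂ a) := fun a => by
    rw [h.ambientDeriv_snd]
    exact (congrArg (fun A : Model n →L[ℝ] Model n => A (_ : Model n)) hQ.self_comp_inverse).symm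
  -- Total symmetry moves v into the differentiation slot. What remains is g applied to
  -- endomorphisms, so contracting with the inverse of g yields their traces.
  have key : ∀ a b, G (f x) (modelK n (secondFundamentalForm G f x a b)) (fderiv ℝ f x v) =
      (1 / 2) * inducedMetric G f x (T₁ a) b - (1 / 2) * inducedMetric G f x (T₂ a) b := by
    intro a b
    have h0 : secondFundamentalForm G f x a b = normalPart G f x (ambientDeriv G f x a b) := rfl
    have e₁ : (fderiv ℝ f x b).1 = leftDeriv f x b := rfl
    have e₂ : (fderiv ℝ f x b).2 = rightDeriv f x b := rfl
    rw [h0, h.apply_modelK_normalPart, h.apply_modelK_ambientDeriv_symm hnd a b v,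
      h.ambientDeriv_symm a v, hG.apply_modelK, h₁, h₂, e₁, e₂, h.inducedMetric_eq,
      h.inducedMetric_eq, h.inner_symm b]
    ring
  have hsum : G (f x) (modelK n (localMeanCurvature G f x)) (fderiv ℝ f x v) =
      (1 / 2) * traceCLM T₁ - (1 / 2) * traceCLM T₂ := by
    rw [← sum_inv_mul_eq_trace hsym h.inducedMetric_nondegenerate,
      ← sum_inv_mul_eq_trace hsym h.inducedMetric_nondegenerate, localMeanCurvature]
    simp only [map_sum, map_smul, sum_apply, smul_apply, smul_eq_mul, Finset.mul_sum,
      ← Finset.sum_sub_distrib]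
    refine Finset.sum_congr rfl fun i _ => Finset.sum_congr rfl fun j _ => ?_
    rw [key]
    ring
  have ht₁ : traceCLM T₁ = fderiv ℝ (fun z => logDet (leftDeriv f z)) x v +
      fderiv ℝ (logDetMixed G) (f x) (inL n (P v)) := by
    rw [hT₁, ContinuousLinearMap.comp_add, map_add, traceCLM_conj hP, fderiv_logDetMixed_left hG,
      fderiv_logDet_comp hP hPd]
  have ht₂ : traceCLM T₂ = fderiv ℝ (fun z => logDet (rightDeriv f z)) x v +
      fderiv ℝ (logDetMixed G) (f x) (inR n (Q v)) := by
    rw [hT₂, ContinuousLinearMap.comp_add, map_add, traceCLM_conj hQ, fderiv_logDetMixed_right hG,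
      fderiv_logDet_comp hQ hQd]
  have hK : modelK n (fderiv ℝ f x v) = inL n (P v) - inR n (Q v) := by
    simp [modelK_apply, hPx, hQx, leftDeriv, rightDeriv]
  have d₁ : DifferentiableAt ℝ (fun z => logDet (leftDeriv f z)) x :=
    DifferentiableAt.comp (g := logDet) x
      ((contDiffAt_logDet (k := 1) hP).differentiableAt one_ne_zero) hPd
  have d₂ : DifferentiableAt ℝ (fun z => logDet (rightDeriv f z)) x :=
    DifferentiableAt.comp (g := logDet) x
      ((contDiffAt_logDet (k := 1) hQ).differentiableAt one_ne_zero) hQd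
  rw [hsum, ht₁, ht₂, logDetForm, fderiv_fun_sub d₁ d₂]
  simp only [smul_apply, add_apply, sub_apply, ContinuousLinearMap.comp_apply, smul_eq_mul, hK,
    map_sub]
  ring

end IsLagrangianAt

end LocalLagrangian

/-! ### Regularity, exterior derivative and coordinate invariance of the determinant expression -/

section LogDetForm

variable {n : ℕ} {G G' : Model n × Model n → Model n × Model n →L[ℝ] Model n × Model n →L[ℝ] ℝ}
  {f f' : Model n → Model n × Model n} {x : Model n}

namespace IsLagrangianAt

theorem contDiffAt_logDet_leftDeriv (h : IsLagrangianAt G f x) :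
    ContDiffAt ℝ 2 (fun z => logDet (leftDeriv f z)) x :=
  ContDiffAt.comp (g := logDet) x (contDiffAt_logDet h.isInvertible_leftDeriv)
    h.contDiffAt_leftDeriv

theorem contDiffAt_logDet_rightDeriv (h : IsLagrangianAt G f x) :
    ContDiffAt ℝ 2 (fun z => logDet (rightDeriv f z)) x :=
  ContDiffAt.comp (g := logDet) x (contDiffAt_logDet h.isInvertible_rightDeriv)
    h.contDiffAt_rightDeriv

/-- f is C³ and the cost is C⁴, so P, Q and S are C²; one derivative of their log-determinants is
then C¹. -/
theorem contDiffAt_logDetForm (h : IsLagrangianAt G f x) :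
    ContDiffAt ℝ 1 (logDetForm G f) x := by
  have h1 : ContDiffAt ℝ 1
      (fderiv ℝ (fun z => logDet (leftDeriv f z) - logDet (rightDeriv f z))) x :=
    (h.contDiffAt_logDet_leftDeriv.sub h.contDiffAt_logDet_rightDeriv).fderiv_right (by norm_num)
  have h2 : ContDiffAt ℝ 1 (fun z => fderiv ℝ (logDetMixed G) (f z)) x :=
    ContDiffAt.comp (g := fderiv ℝ (logDetMixed G)) x
      (h.isKimMcCannAt.contDiffAt_logDetMixed.fderiv_right (by norm_num))
      (h.contDiffAt.of_le (by norm_num))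
  have h3 : ContDiffAt ℝ 1 (fderiv ℝ f) x := h.contDiffAt.fderiv_right (by norm_num)
  exact (h1.add (h2.clm_comp (contDiffAt_const.clm_comp h3))).const_smul (1 / 2 : ℝ)

theorem fderiv_logDetForm (h : IsLagrangianAt G f x) (u v : Model n) :
    fderiv ℝ (logDetForm G f) x u v = (1 / 2) *
      (fderiv ℝ (fderiv ℝ fun z => logDet (leftDeriv f z) - logDet (rightDeriv f z)) x u v
      + fderiv ℝ (fderiv ℝ (logDetMixed G)) (f x) (fderiv ℝ f x u) (modelK n (fderiv ℝ f x v))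
      + fderiv ℝ (logDetMixed G) (f x) (modelK n (fderiv ℝ (fderiv ℝ f) x u v))) := by
  have h1 : HasFDerivAt
      (fderiv ℝ (fun z => logDet (leftDeriv f z) - logDet (rightDeriv f z))) _ x :=
    (((h.contDiffAt_logDet_leftDeriv.sub h.contDiffAt_logDet_rightDeriv).fderiv_right
      (m := 1) (by norm_num)).differentiableAt one_ne_zero).hasFDerivAt
  have h2 : HasFDerivAt (fun z => fderiv ℝ (logDetMixed G) (f z)) _ x :=
    HasFDerivAt.comp (g := fderiv ℝ (logDetMixed G)) x
      ((h.isKimMcCannAt.contDiffAt_logDetMixed.fderiv_right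
        (m := 1) (by norm_num)).differentiableAt one_ne_zero).hasFDerivAt
      (h.contDiffAt.differentiableAt three_ne_zero).hasFDerivAt
  have h3 := h.differentiableAt_fderiv.hasFDerivAt
  have h4 : HasFDerivAt (logDetForm G f) _ x := (h1.fun_add (h2.clm_comp
    ((hasFDerivAt_const (modelK n) x).clm_comp h3))).const_smul (1 / 2 : ℝ)
  rw [h4.fderiv]
  simp
  ring

/-- Symmetry of second derivatives removes the exact term and the term with the second derivative of
f. There remains ½ (D²Φ(a, Kb) - D²Φ(b, Ka)) with a = ∂_u f and b = ∂_v f. Its pure blocks cancel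
and its mixed blocks double. -/
theorem fderiv_logDetForm_sub (h : IsLagrangianAt G f x) (u v : Model n) :
    fderiv ℝ (logDetForm G f) x u v - fderiv ℝ (logDetForm G f) x v u =
      localRicci G (f x) (modelK n (fderiv ℝ f x u)) (fderiv ℝ f x v) := by
  have s1 : IsSymmSndFDerivAt ℝ (fun z => logDet (leftDeriv f z) - logDet (rightDeriv f z)) x :=
    (h.contDiffAt_logDet_leftDeriv.sub h.contDiffAt_logDet_rightDeriv).isSymmSndFDerivAt (by simp)
  have s2 : IsSymmSndFDerivAt ℝ f x :=
    (h.contDiffAt.of_le (by norm_num : (2 : WithTop ℕ∞) ≤ 3)).isSymmSndFDerivAt (by simp)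
  have s3 : IsSymmSndFDerivAt ℝ (logDetMixed G) (f x) :=
    h.isKimMcCannAt.contDiffAt_logDetMixed.isSymmSndFDerivAt (by simp)
  rw [h.fderiv_logDetForm, h.fderiv_logDetForm, s1.eq v u, s2.eq v u,
    h.isKimMcCannAt.localRicci_eq, modelK_apply, modelK_apply, modelK_apply]
  generalize fderiv ℝ f x u = a
  generalize fderiv ℝ f x v = b
  set D := fderiv ℝ (fderiv ℝ (logDetMixed G)) (f x) with hD
  have e : ∀ (a b : Model n × Model n), D a (b.1, -b.2) =
      D (a.1, 0) (b.1, 0) + D (0, a.2) (b.1, 0) - D (a.1, 0) (0, b.2) - D (0, a.2) (0, b.2) := by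
    intro a b
    have h1 : a = (a.1, 0) + (0, a.2) := by simp
    have h2 : (b.1, -b.2) = (b.1, 0) - (0, b.2) := by simp
    conv_lhs => rw [h1, h2]
    simp only [map_add, map_sub, add_apply]
    ring
  have hneg : ((0 : Model n), -a.2) = -(0, a.2) := by simp
  rw [e, e, s3.eq (b.1, 0) (a.1, 0), s3.eq (0, b.2) (a.1, 0), s3.eq (b.1, 0) (0, a.2),
    s3.eq (0, b.2) (0, a.2), hneg, map_neg, neg_apply]
  ring

/-- The mean curvature form does not depend on the choice of coordinates. -/
theorem logDetForm_comp {t s₁ s₂ : Model n → Model n} (h : IsLagrangianAt G f (t x))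
    (hG' : IsKimMcCannAt G' (f' x))
    (ht : ContDiffAt ℝ 2 t x) (hti : (fderiv ℝ t x).IsInvertible)
    (hs₁ : ContDiffAt ℝ 2 s₁ (f (t x)).1) (hsi₁ : (fderiv ℝ s₁ (f (t x)).1).IsInvertible)
    (hs₂ : ContDiffAt ℝ 2 s₂ (f (t x)).2) (hsi₂ : (fderiv ℝ s₂ (f (t x)).2).IsInvertible)
    (hf : f' =ᶠ[𝓝 x] fun z => (s₁ (f (t z)).1, s₂ (f (t z)).2))
    (hG : ∀ᶠ z in 𝓝 (f (t x)), ∀ u v, G z u v = G' (s₁ z.1, s₂ z.2)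
      (fderiv ℝ s₁ z.1 u.1, fderiv ℝ s₂ z.2 u.2) (fderiv ℝ s₁ z.1 v.1, fderiv ℝ s₂ z.2 v.2))
    (v : Model n) :
    logDetForm G' f' x v = logDetForm G f (t x) (fderiv ℝ t x v) := by
  set l₁ : Model n → ℝ := fun z => logDet (fderiv ℝ s₁ z) with hl₁
  set l₂ : Model n → ℝ := fun z => logDet (fderiv ℝ s₂ z) with hl₂
  have cs₁ : ContDiffAt ℝ 1 (fderiv ℝ s₁) (f (t x)).1 := hs₁.fderiv_right (by norm_num)
  have cs₂ : ContDiffAt ℝ 1 (fderiv ℝ s₂) (f (t x)).2 := hs₂.fderiv_right (by norm_num)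
  have ct : ContDiffAt ℝ 1 (fderiv ℝ t) x := ht.fderiv_right (by norm_num)
  have dl₁ : DifferentiableAt ℝ l₁ (f (t x)).1 :=
    (ContDiffAt.comp (n := 1) (g := logDet) _ (contDiffAt_logDet hsi₁) cs₁).differentiableAt
      one_ne_zero
  have dl₂ : DifferentiableAt ℝ l₂ (f (t x)).2 :=
    (ContDiffAt.comp (n := 1) (g := logDet) _ (contDiffAt_logDet hsi₂) cs₂).differentiableAt
      one_ne_zero
  have dt := (ht.differentiableAt two_ne_zero)
  have df := h.contDiffAt.differentiableAt three_ne_zero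
  have dft : HasFDerivAt (fun z => f (t z)) ((fderiv ℝ f (t x)).comp (fderiv ℝ t x)) x :=
    df.hasFDerivAt.comp x dt.hasFDerivAt
  have cft : ContinuousAt (fun z => f (t z)) x := dft.continuousAt
  -- the derivative of `f'`
  have hf' : ∀ᶠ z in 𝓝 x, fderiv ℝ f' z =
      ((fderiv ℝ s₁ (f (t z)).1).comp ((leftDeriv f (t z)).comp (fderiv ℝ t z))).prod
      ((fderiv ℝ s₂ (f (t z)).2).comp ((rightDeriv f (t z)).comp (fderiv ℝ t z))) := by
    filter_upwards [hf.eventuallyEq_nhds, ht.eventually (by simp),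
      ht.continuousAt.eventually (h.contDiffAt.eventually (by simp)),
      (cft.fst).eventually (hs₁.eventually (by simp)),
      (cft.snd).eventually (hs₂.eventually (by simp))] with z h1 h2 h3 h4 h5
    have e1 : HasFDerivAt (fun z => f (t z)) ((fderiv ℝ f (t z)).comp (fderiv ℝ t z)) z :=
      (h3.differentiableAt three_ne_zero).hasFDerivAt.comp z
        (h2.differentiableAt two_ne_zero).hasFDerivAt
    have e2 := ((h4.differentiableAt two_ne_zero).hasFDerivAt.comp z e1.fst).prodMk
      ((h5.differentiableAt two_ne_zero).hasFDerivAt.comp z e1.snd)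
    rw [h1.fderiv_eq]
    exact e2.fderiv
  have iP := h.isInvertible_leftDeriv
  have iQ := h.isInvertible_rightDeriv
  -- P and Q are both composed with the derivative of t, so its determinant drops out of the
  -- difference; only those of s₁ and s₂ remain.
  have hlam : (fun z => logDet (leftDeriv f' z) - logDet (rightDeriv f' z)) =ᶠ[𝓝 x]
      fun z => (logDet (leftDeriv f (t z)) - logDet (rightDeriv f (t z)))
        + (l₁ (f (t z)).1 - l₂ (f (t z)).2) := by
    filter_upwards [hf', eventually_isInvertible hti ct.continuousAt,
      ht.continuousAt.eventually
        (eventually_isInvertible iP h.contDiffAt_leftDeriv.continuousAt),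
      ht.continuousAt.eventually
        (eventually_isInvertible iQ h.contDiffAt_rightDeriv.continuousAt),
      (cft.fst).eventually (eventually_isInvertible hsi₁ cs₁.continuousAt),
      (cft.snd).eventually (eventually_isInvertible hsi₂ cs₂.continuousAt)] with z h1 h2 h3 h4 h5 h6
    have e1 : leftDeriv f' z =
        (fderiv ℝ s₁ (f (t z)).1).comp ((leftDeriv f (t z)).comp (fderiv ℝ t z)) := by
      rw [leftDeriv, h1]; rfl
    have e2 : rightDeriv f' z =
        (fderiv ℝ s₂ (f (t z)).2).comp ((rightDeriv f (t z)).comp (fderiv ℝ t z)) := by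
      rw [rightDeriv, h1]; rfl
    rw [e1, e2, logDet_comp h5 (h3.comp h2), logDet_comp h3 h2, logDet_comp h6 (h4.comp h2),
      logDet_comp h4 h2]
    ring
  -- The mixed endomorphism transforms as S = (Ds₂)* S' Ds₁.
  have hPhi : logDetMixed G =ᶠ[𝓝 (f (t x))] fun z =>
      logDetMixed G' (s₁ z.1, s₂ z.2) + (l₁ z.1 + l₂ z.2) := by
    have hc : ContinuousAt (fun z : Model n × Model n => (s₁ z.1, s₂ z.2)) (f (t x)) :=
      (hs₁.continuousAt.comp continuousAt_fst).prodMk (hs₂.continuousAt.comp continuousAt_snd)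
    have hev := hG'.eventually
    rw [hf.self_of_nhds] at hev
    filter_upwards [hG, hc.eventually hev,
      continuousAt_fst.eventually (eventually_isInvertible hsi₁ cs₁.continuousAt),
      continuousAt_snd.eventually (eventually_isInvertible hsi₂ cs₂.continuousAt)]
      with z h1 h2 h3 h4
    have hadj : (ContinuousLinearMap.adjoint (fderiv ℝ s₂ z.2)).det = (fderiv ℝ s₂ z.2).det :=
      det_eq_of_inner_eq fun v w => ContinuousLinearMap.adjoint_inner_left _ _ _
    have e : mixedEnd G (inL n) (inR n) z = (ContinuousLinearMap.adjoint (fderiv ℝ s₂ z.2)).comp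
        ((mixedEnd G' (inL n) (inR n) (s₁ z.1, s₂ z.2)).comp (fderiv ℝ s₁ z.1)) := by
      refine ContinuousLinearMap.ext fun v => ext_inner_right ℝ fun w => ?_
      rw [inner_mixedEnd, h1, ContinuousLinearMap.comp_apply,
        ContinuousLinearMap.adjoint_inner_left, ContinuousLinearMap.comp_apply, inner_mixedEnd]
      simp
    have hadji : (ContinuousLinearMap.adjoint (fderiv ℝ s₂ z.2)).IsInvertible := by
      rw [← det_ne_zero_iff, hadj, det_ne_zero_iff]; exact h4
    rw [logDetMixed, e, logDet_comp hadji (h2.isInvertible_left.comp h3),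
      logDet_comp h2.isInvertible_left h3, logDet, hadj, hl₁, hl₂]
    simp only [logDetMixed, logDet]
    ring
  have dlam :
      DifferentiableAt ℝ (fun z => logDet (leftDeriv f z) - logDet (rightDeriv f z)) (t x) :=
    (h.contDiffAt_logDet_leftDeriv.sub h.contDiffAt_logDet_rightDeriv).differentiableAt two_ne_zero
  have dlam' : HasFDerivAt (fun z => (logDet (leftDeriv f (t z)) - logDet (rightDeriv f (t z)))
        + (l₁ (f (t z)).1 - l₂ (f (t z)).2)) _ x :=
    (dlam.hasFDerivAt.comp x dt.hasFDerivAt).fun_add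
      ((dl₁.hasFDerivAt.comp x dft.fst).fun_sub (dl₂.hasFDerivAt.comp x dft.snd))
  have dPhi : DifferentiableAt ℝ (logDetMixed G') (s₁ (f (t x)).1, s₂ (f (t x)).2) := by
    have := hG'.contDiffAt_logDetMixed.differentiableAt two_ne_zero
    rwa [hf.self_of_nhds] at this
  have ds : HasFDerivAt (fun z : Model n × Model n => (s₁ z.1, s₂ z.2)) _ (f (t x)) :=
    ((hs₁.differentiableAt two_ne_zero).hasFDerivAt.comp (f (t x)) hasFDerivAt_fst).prodMk
      ((hs₂.differentiableAt two_ne_zero).hasFDerivAt.comp (f (t x)) hasFDerivAt_snd)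
  have dPhi' : HasFDerivAt (fun z : Model n × Model n =>
      logDetMixed G' (s₁ z.1, s₂ z.2) + (l₁ z.1 + l₂ z.2)) _ (f (t x)) :=
    (HasFDerivAt.comp (g := logDetMixed G') (f (t x)) dPhi.hasFDerivAt ds).fun_add
      ((dl₁.hasFDerivAt.comp (f (t x)) hasFDerivAt_fst).fun_add
        (dl₂.hasFDerivAt.comp (f (t x)) hasFDerivAt_snd))
  -- Twisting by K turns the correction l₁ + l₂ of Φ into dl₁ ∘ P - dl₂ ∘ Q, which cancels the
  -- correction l₁ - l₂ from `hlam`.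
  simp only [logDetForm, smul_apply, add_apply, ContinuousLinearMap.comp_apply]
  rw [hlam.fderiv_eq, dlam'.fderiv, hPhi.fderiv_eq, dPhi'.fderiv, hf'.self_of_nhds,
    hf.self_of_nhds, modelK_apply, modelK_apply]
  simp [leftDeriv, rightDeriv]
  ring

end IsLagrangianAt

end LogDetForm

/-! ### Preferred charts and transition maps -/

section Charts

variable {n : ℕ} {X : Type*} [TopologicalSpace X] [ChartedSpace (EuclideanSpace ℝ (Fin n)) X]

/-- The derivative of the inverse of the preferred chart at `p`. -/
def chartSymmDeriv (p : X) (y : Model n) : Model n →L[ℝ] Model n :=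
  mfderiv 𝓘(ℝ, Model n) (𝓡 n) (extChartAt (𝓡 n) p).symm y

/-- The transition function from the preferred chart at `p` to the preferred chart at `q`. -/
def transition (p q : X) : Model n → Model n :=
  fun y => extChartAt (𝓡 n) q ((extChartAt (𝓡 n) p).symm y)

theorem contMDiffAt_extChartAt_symm {p : X} {y : Model n} (hy : y ∈ (extChartAt (𝓡 n) p).target)
    {k : WithTop ℕ∞} [IsManifold (𝓡 n) k X] :
    ContMDiffAt 𝓘(ℝ, Model n) (𝓡 n) k (extChartAt (𝓡 n) p).symm y :=
  (contMDiffOn_extChartAt_symm p).contMDiffAt ((isOpen_extChartAt_target p).mem_nhds hy)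

variable [IsManifold (𝓡 n) ∞ X]

theorem mdifferentiableAt_extChartAt_symm {p : X} {y : Model n}
    (hy : y ∈ (extChartAt (𝓡 n) p).target) :
    MDifferentiableAt 𝓘(ℝ, Model n) (𝓡 n) (extChartAt (𝓡 n) p).symm y :=
  (contMDiffAt_extChartAt_symm (k := ∞) hy).mdifferentiableAt (by simp)

theorem isInvertible_chartSymmDeriv {p : X} {y : Model n}
    (hy : y ∈ (extChartAt (𝓡 n) p).target) : (chartSymmDeriv p y).IsInvertible := by
  have : IsManifold (𝓡 n) 1 X := .of_le (n := ∞) (by simp)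
  have h := isInvertible_mfderivWithin_extChartAt_symm (I := 𝓡 n) hy
  rw [ModelWithCorners.range_eq_univ, mfderivWithin_univ] at h
  exact h

/-- Tangent vectors at p are by convention read in the preferred chart at p, so no conversion is
needed at the base point. -/
theorem chartSymmDeriv_self (p : X) :
    chartSymmDeriv p (extChartAt (𝓡 n) p p) = ContinuousLinearMap.id ℝ (Model n) := by
  have : IsManifold (𝓡 n) 1 X := .of_le (n := ∞) (by simp)
  have h := mfderivWithin_range_extChartAt_symm (I := 𝓡 n) (x := p)
  rw [ModelWithCorners.range_eq_univ, mfderivWithin_univ] at h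
  exact h

theorem contDiffAt_transition {p q : X} {y : Model n} (hy : y ∈ (extChartAt (𝓡 n) p).target)
    (hq : (extChartAt (𝓡 n) p).symm y ∈ (extChartAt (𝓡 n) q).source) :
    ContDiffAt ℝ ∞ (transition p q) y := by
  rw [← contMDiffAt_iff_contDiffAt]
  exact (contMDiffAt_extChartAt' (by rwa [extChartAt_source] at hq)).comp y
    (contMDiffAt_extChartAt_symm hy)

theorem chartSymmDeriv_transition {p q : X} {y : Model n}
    (hy : y ∈ (extChartAt (𝓡 n) p).target)
    (hq : (extChartAt (𝓡 n) p).symm y ∈ (extChartAt (𝓡 n) q).source) :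
    chartSymmDeriv p y =
      (chartSymmDeriv q (transition p q y)).comp (fderiv ℝ (transition p q) y) := by
  have h1 : (extChartAt (𝓡 n) p).symm =ᶠ[𝓝 y] (extChartAt (𝓡 n) q).symm ∘ transition p q := by
    have hc := (mdifferentiableAt_extChartAt_symm hy).continuousAt
    filter_upwards [hc.preimage_mem_nhds ((isOpen_extChartAt_source q).mem_nhds hq)] with z hz
    exact ((extChartAt (𝓡 n) q).left_inv hz).symm
  have h2 : MDifferentiableAt 𝓘(ℝ, Model n) 𝓘(ℝ, Model n) (transition p q) y :=
    ((contDiffAt_transition hy hq).differentiableAt (by simp)).mdifferentiableAt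
  have h3 : transition p q y ∈ (extChartAt (𝓡 n) q).target := (extChartAt (𝓡 n) q).map_source hq
  have h4 := mfderiv_comp y (mdifferentiableAt_extChartAt_symm h3) h2
  rw [mfderiv_eq_fderiv] at h4
  rw [chartSymmDeriv, h1.mfderiv_eq]
  exact h4

theorem isInvertible_fderiv_transition {p q : X} {y : Model n}
    (hy : y ∈ (extChartAt (𝓡 n) p).target)
    (hq : (extChartAt (𝓡 n) p).symm y ∈ (extChartAt (𝓡 n) q).source) :
    (fderiv ℝ (transition p q) y).IsInvertible := by
  rw [← det_ne_zero_iff]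
  have h := det_ne_zero_iff.2 (isInvertible_chartSymmDeriv hy)
  rw [chartSymmDeriv_transition hy hq, det_comp] at h
  exact right_ne_zero_of_mul h

end Charts

/-! ### The metric in charts of the product -/

section ProductCharts

variable {n : ℕ}
  {M : Type*} [TopologicalSpace M] [ChartedSpace (EuclideanSpace ℝ (Fin n)) M]
  {N : Type*} [TopologicalSpace N] [ChartedSpace (EuclideanSpace ℝ (Fin n)) N]

/-- The metric of a Kim–McCann structure, as a function with values in a fixed vector space. -/
def Structure.metric (S : Structure n M N) (q : M × N) :
    Model n × Model n →L[ℝ] Model n × Model n →L[ℝ] ℝ := S.h q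

/-- The domain of the preferred chart at a point of a product. -/
theorem mem_extChartAt_prod_target {q : M × N} {z : Model n × Model n} :
    z ∈ (extChartAt ((𝓡 n).prod (𝓡 n)) q).target ↔
      z.1 ∈ (extChartAt (𝓡 n) q.1).target ∧ z.2 ∈ (extChartAt (𝓡 n) q.2).target := by
  rw [extChartAt_prod]; rfl

theorem extChartAt_prod_symm_apply (q : M × N) (z : Model n × Model n) :
    (extChartAt ((𝓡 n).prod (𝓡 n)) q).symm z =
      ((extChartAt (𝓡 n) q.1).symm z.1, (extChartAt (𝓡 n) q.2).symm z.2) := by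
  rw [extChartAt_prod]; rfl

theorem extChartAt_prod_apply (q r : M × N) :
    extChartAt ((𝓡 n).prod (𝓡 n)) q r =
      (extChartAt (𝓡 n) q.1 r.1, extChartAt (𝓡 n) q.2 r.2) := by
  rw [extChartAt_prod]; rfl

variable [IsManifold (𝓡 n) ∞ M] [IsManifold (𝓡 n) ∞ N]

theorem mfderiv_extChartAt_prod_symm {q : M × N} {z : Model n × Model n}
    (hz : z ∈ (extChartAt ((𝓡 n).prod (𝓡 n)) q).target) :
    (mfderiv 𝓘(ℝ, Model n × Model n) ((𝓡 n).prod (𝓡 n)) (extChartAt ((𝓡 n).prod (𝓡 n)) q).symm z :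
      Model n × Model n →L[ℝ] Model n × Model n) =
      (chartSymmDeriv q.1 z.1).prodMap (chartSymmDeriv q.2 z.2) := by
  rw [mem_extChartAt_prod_target] at hz
  have h := mfderiv_prodMap (p := z) (mdifferentiableAt_extChartAt_symm hz.1)
    (mdifferentiableAt_extChartAt_symm hz.2)
  have e : ((extChartAt ((𝓡 n).prod (𝓡 n)) q).symm : Model n × Model n → M × N) =
    Prod.map (extChartAt (𝓡 n) q.1).symm (extChartAt (𝓡 n) q.2).symm := by
    rw [extChartAt_prod]; rfl
  -- The product of two vector spaces carries two manifold structures, its own and the product one;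
  -- these rewrites identify them.
  rw [← modelWithCornersSelf_prod, chartedSpaceSelf_prod] at h
  rw [e]
  exact h

theorem Structure.chartMetric_apply (S : Structure n M N) {q : M × N} {z : Model n × Model n}
    (hz : z ∈ (extChartAt ((𝓡 n).prod (𝓡 n)) q).target) (u v : Model n × Model n) :
    chartMetric ((𝓡 n).prod (𝓡 n)) S.h q z u v =
      S.metric ((extChartAt ((𝓡 n).prod (𝓡 n)) q).symm z)
        (chartSymmDeriv q.1 z.1 u.1, chartSymmDeriv q.2 z.2 u.2)
        (chartSymmDeriv q.1 z.1 v.1, chartSymmDeriv q.2 z.2 v.2) := by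
  have h := mfderiv_extChartAt_prod_symm hz
  change S.metric _ ((mfderiv 𝓘(ℝ, Model n × Model n) ((𝓡 n).prod (𝓡 n))
      (extChartAt ((𝓡 n).prod (𝓡 n)) q).symm z : Model n × Model n →L[ℝ] Model n × Model n) u)
    ((mfderiv 𝓘(ℝ, Model n × Model n) ((𝓡 n).prod (𝓡 n))
      (extChartAt ((𝓡 n).prod (𝓡 n)) q).symm z : Model n × Model n →L[ℝ] Model n × Model n) v) = _
  rw [h]
  rfl

/-- Product charts change factor by factor, which is the form of coordinate change that
`logDetForm_comp` requires. -/
theorem Structure.chartMetric_transition (S : Structure n M N) {q r : M × N}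
    {z : Model n × Model n} (hz : z ∈ (extChartAt ((𝓡 n).prod (𝓡 n)) q).target)
    (hr : (extChartAt ((𝓡 n).prod (𝓡 n)) q).symm z ∈
      (extChartAt ((𝓡 n).prod (𝓡 n)) r).source) (u v : Model n × Model n) :
    chartMetric ((𝓡 n).prod (𝓡 n)) S.h q z u v =
      chartMetric ((𝓡 n).prod (𝓡 n)) S.h r (transition q.1 r.1 z.1, transition q.2 r.2 z.2)
        (fderiv ℝ (transition q.1 r.1) z.1 u.1, fderiv ℝ (transition q.2 r.2) z.2 u.2)
        (fderiv ℝ (transition q.1 r.1) z.1 v.1, fderiv ℝ (transition q.2 r.2) z.2 v.2) := by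
  have e : (transition q.1 r.1 z.1, transition q.2 r.2 z.2) =
      extChartAt ((𝓡 n).prod (𝓡 n)) r ((extChartAt ((𝓡 n).prod (𝓡 n)) q).symm z) := by
    rw [extChartAt_prod_symm_apply, extChartAt_prod_apply]; rfl
  have ht := (extChartAt ((𝓡 n).prod (𝓡 n)) r).map_source hr
  rw [← e] at ht
  rw [S.chartMetric_apply hz, S.chartMetric_apply ht, e,
    (extChartAt ((𝓡 n).prod (𝓡 n)) r).left_inv hr]
  rw [mem_extChartAt_prod_target] at hz
  have hr1 : (extChartAt (𝓡 n) q.1).symm z.1 ∈ (extChartAt (𝓡 n) r.1).source ∧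
      (extChartAt (𝓡 n) q.2).symm z.2 ∈ (extChartAt (𝓡 n) r.2).source := by
    rw [extChartAt_prod_symm_apply, extChartAt_prod] at hr; exact hr
  rw [chartSymmDeriv_transition hz.1 hr1.1, chartSymmDeriv_transition hz.2 hr1.2, ← e]
  rfl

end ProductCharts

theorem four_le_infty : (4 : WithTop ℕ∞) ≤ ∞ := by
  exact ENat.LEInfty.out

/-! ### The cost function in charts -/

section Cost

variable {n : ℕ}
  {M : Type*} [TopologicalSpace M] [ChartedSpace (EuclideanSpace ℝ (Fin n)) M]
  {N : Type*} [TopologicalSpace N] [ChartedSpace (EuclideanSpace ℝ (Fin n)) N]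

theorem Structure.metric_apply (S : Structure n M N) {q : M × N} (hq : q ∉ S.cutLocus)
    (u v : Model n × Model n) :
    S.metric q u v = S.h q (pair q u.1 0) (pair q 0 v.2) + S.h q (pair q v.1 0) (pair q 0 u.2) := by
  have e : ∀ u : Model n × Model n, u = (u.1, 0) + (0, u.2) := fun u => by simp
  have h1 : S.metric q (u.1, 0) (v.1, 0) = 0 := S.null_left q hq u.1 v.1
  have h2 : S.metric q (0, u.2) (0, v.2) = 0 := S.null_right q hq u.2 v.2
  have h3 : S.metric q (0, u.2) (v.1, 0) = S.metric q (v.1, 0) (0, u.2) := S.symm q hq _ _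
  change _ = S.metric q (u.1, 0) (0, v.2) + S.metric q (v.1, 0) (0, u.2)
  conv_lhs => rw [e u, e v]
  simp only [map_add, add_apply, h1, h2, h3]
  ring

/-- The derivative of a real function on a manifold. -/
def realDeriv {X : Type*} [TopologicalSpace X] [ChartedSpace (EuclideanSpace ℝ (Fin n)) X]
    (g : X → ℝ) (x : X) : Model n →L[ℝ] ℝ := mfderiv (𝓡 n) 𝓘(ℝ, ℝ) g x

theorem crossDeriv_eq_realDeriv (c : M × N → ℝ) (q : M × N) (v w : Model n) :
    crossDeriv (n := n) c q v w =
      realDeriv (fun x => realDeriv (fun y => c (x, y)) q.2 w) q.1 v := rfl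

variable [IsManifold (𝓡 n) ∞ M] [IsManifold (𝓡 n) ∞ N]

theorem contDiffAt_comp_extChartAt_symm {q : M × N} {z : Model n × Model n}
    (hz : z ∈ (extChartAt ((𝓡 n).prod (𝓡 n)) q).target) {c : M × N → ℝ}
    (hc : ContMDiffAt ((𝓡 n).prod (𝓡 n)) 𝓘(ℝ, ℝ) 4 c ((extChartAt ((𝓡 n).prod (𝓡 n)) q).symm z)) :
    ContDiffAt ℝ 4 (fun z => c ((extChartAt ((𝓡 n).prod (𝓡 n)) q).symm z)) z := by
  have : IsManifold ((𝓡 n).prod (𝓡 n)) 4 (M × N) := .of_le (n := ∞) four_le_infty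
  rw [← contMDiffAt_iff_contDiffAt]
  exact hc.comp z ((contMDiffOn_extChartAt_symm q).contMDiffAt
    ((isOpen_extChartAt_target q).mem_nhds hz))

theorem realDeriv_chartSymmDeriv {X : Type*} [TopologicalSpace X]
    [ChartedSpace (EuclideanSpace ℝ (Fin n)) X] [IsManifold (𝓡 n) ∞ X] {p : X} {y : Model n}
    (hy : y ∈ (extChartAt (𝓡 n) p).target) {g : X → ℝ}
    (hg : MDifferentiableAt (𝓡 n) 𝓘(ℝ, ℝ) g ((extChartAt (𝓡 n) p).symm y)) (v : Model n) :
    realDeriv g ((extChartAt (𝓡 n) p).symm y) (chartSymmDeriv p y v) =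
      fderiv ℝ (fun y => g ((extChartAt (𝓡 n) p).symm y)) y v := by
  have h := mfderiv_comp y hg (mdifferentiableAt_extChartAt_symm hy)
  rw [mfderiv_eq_fderiv] at h
  exact (congrArg (fun T : Model n →L[ℝ] ℝ => T v) h).symm

/-- The iterated manifold derivative is computed one factor at a time. The inner derivative must be
identified for all x near x₀, not only at x₀, before the outer one can be taken. -/
theorem crossDeriv_chart {q : M × N} {z : Model n × Model n}
    (hz : z ∈ (extChartAt ((𝓡 n).prod (𝓡 n)) q).target) {c : M × N → ℝ}
    (hc : ContMDiffAt ((𝓡 n).prod (𝓡 n)) 𝓘(ℝ, ℝ) 4 c ((extChartAt ((𝓡 n).prod (𝓡 n)) q).symm z))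
    (v w : Model n) :
    crossDeriv (n := n) c ((extChartAt (𝓡 n) q.1).symm z.1, (extChartAt (𝓡 n) q.2).symm z.2)
        (chartSymmDeriv q.1 z.1 v) (chartSymmDeriv q.2 z.2 w) =
      fderiv ℝ (fderiv ℝ fun z => c ((extChartAt ((𝓡 n).prod (𝓡 n)) q).symm z)) z
        (v, 0) (0, w) := by
  set C : Model n × Model n → ℝ := fun z => c ((extChartAt ((𝓡 n).prod (𝓡 n)) q).symm z) with hC
  have hCd : ContDiffAt ℝ 4 C z := contDiffAt_comp_extChartAt_symm hz hc
  have hz' := mem_extChartAt_prod_target.1 hz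
  set x₀ := (extChartAt (𝓡 n) q.1).symm z.1 with hx₀
  set y₀ := (extChartAt (𝓡 n) q.2).symm z.2 with hy₀
  have hx₀s : x₀ ∈ (extChartAt (𝓡 n) q.1).source := (extChartAt (𝓡 n) q.1).map_target hz'.1
  have hx₀z : extChartAt (𝓡 n) q.1 x₀ = z.1 := (extChartAt (𝓡 n) q.1).right_inv hz'.1
  have hφd : MDifferentiableAt (𝓡 n) 𝓘(ℝ, Model n) (extChartAt (𝓡 n) q.1) x₀ :=
    (contMDiffAt_extChartAt' (n := ∞) (by rwa [extChartAt_source] at hx₀s)).mdifferentiableAt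
      (by simp)
  rw [extChartAt_prod_symm_apply] at hc
  -- the inner derivative
  have hc0 : ∀ᶠ x in 𝓝 x₀, ContMDiffAt ((𝓡 n).prod (𝓡 n)) 𝓘(ℝ, ℝ) 4 c (x, y₀) := by
    have h1 : ContinuousAt (fun x : M => (x, y₀)) x₀ := by fun_prop
    have : IsManifold ((𝓡 n).prod (𝓡 n)) 4 (M × N) := .of_le (n := ∞) four_le_infty
    exact h1.eventually ((contMDiffAt_iff_contMDiffAt_nhds (by simp)).1 hc)
  have hC0 : ∀ᶠ x in 𝓝 x₀, DifferentiableAt ℝ C (extChartAt (𝓡 n) q.1 x, z.2) := by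
    have h1 : ContinuousAt (fun x : M => (extChartAt (𝓡 n) q.1 x, z.2)) x₀ :=
      hφd.continuousAt.prodMk continuousAt_const
    have h2 : ∀ᶠ z' in 𝓝 (extChartAt (𝓡 n) q.1 x₀, z.2), ContDiffAt ℝ 4 C z' := by
      rw [hx₀z]; exact hCd.eventually (by simp)
    filter_upwards [h1.eventually h2] with x hx using hx.differentiableAt (by simp)
  have hD : (fun x : M => realDeriv (fun y => c (x, y)) y₀ (chartSymmDeriv q.2 z.2 w)) =ᶠ[𝓝 x₀]
      fun x => fderiv ℝ C (extChartAt (𝓡 n) q.1 x, z.2) (0, w) := by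
    filter_upwards [hc0, hC0, (isOpen_extChartAt_source q.1).mem_nhds hx₀s] with x h1 h2 h3
    have e1 : MDifferentiableAt (𝓡 n) 𝓘(ℝ, ℝ) (fun y : N => c (x, y)) y₀ :=
      (h1.mdifferentiableAt (by simp)).comp y₀
        (mdifferentiableAt_const.prodMk mdifferentiableAt_id)
    have e3 : (fun y => c (x, (extChartAt (𝓡 n) q.2).symm y)) =
        fun y => C (extChartAt (𝓡 n) q.1 x, y) := by
      funext y
      simp only [hC, extChartAt_prod_symm_apply]
      rw [(extChartAt (𝓡 n) q.1).left_inv h3]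
    have e4 : HasFDerivAt (fun y => C (extChartAt (𝓡 n) q.1 x, y)) _ z.2 :=
      HasFDerivAt.comp (g := C) z.2 h2.hasFDerivAt
        ((hasFDerivAt_const (extChartAt (𝓡 n) q.1 x) z.2).prodMk (hasFDerivAt_id z.2))
    rw [realDeriv_chartSymmDeriv hz'.2 e1, e3, e4.fderiv]
    rfl
  have hCdd : DifferentiableAt ℝ (fderiv ℝ C) z :=
    (hCd.fderiv_right (m := 3) (by norm_num)).differentiableAt three_ne_zero
  have hE : HasFDerivAt (fun y : Model n => fderiv ℝ C (y, z.2) (0, w))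
      ((ContinuousLinearMap.apply ℝ ℝ ((0 : Model n), w)).comp ((fderiv ℝ (fderiv ℝ C) z).comp
        ((ContinuousLinearMap.id ℝ (Model n)).prod 0))) z.1 :=
    (ContinuousLinearMap.apply ℝ ℝ ((0 : Model n), w)).hasFDerivAt.comp z.1
      (HasFDerivAt.comp (g := fderiv ℝ C) z.1 hCdd.hasFDerivAt
        ((hasFDerivAt_id z.1).prodMk (hasFDerivAt_const z.2 z.1)))
  -- The chain rule for the outer derivative needs genuine differentiability, because `mfderiv`
  -- defaults to zero without it.
  have hEd : MDifferentiableAt (𝓡 n) 𝓘(ℝ, ℝ)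
      (fun x : M => fderiv ℝ C (extChartAt (𝓡 n) q.1 x, z.2) (0, w)) x₀ := by
    refine MDifferentiableAt.comp (g := fun y : Model n => fderiv ℝ C (y, z.2) (0, w)) x₀ ?_ hφd
    rw [hx₀z]
    exact hE.differentiableAt.mdifferentiableAt
  have k2 : (fun y => realDeriv (fun y' => c ((extChartAt (𝓡 n) q.1).symm y, y')) y₀
      (chartSymmDeriv q.2 z.2 w)) =ᶠ[𝓝 z.1] fun y : Model n => fderiv ℝ C (y, z.2) (0, w) := by
    filter_upwards [(mdifferentiableAt_extChartAt_symm hz'.1).continuousAt.eventually hD,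
      (isOpen_extChartAt_target q.1).mem_nhds hz'.1] with y h1 h2
    rw [h1, (extChartAt (𝓡 n) q.1).right_inv h2]
  rw [crossDeriv_eq_realDeriv, realDeriv_chartSymmDeriv hz'.1 (hEd.congr_of_eventuallyEq hD),
    k2.fderiv_eq, hE.fderiv]
  rfl

theorem Structure.isKimMcCannAt_chartMetric (S : Structure n M N) {q : M × N}
    {z : Model n × Model n} (hz : z ∈ (extChartAt ((𝓡 n).prod (𝓡 n)) q).target)
    (hcut : (extChartAt ((𝓡 n).prod (𝓡 n)) q).symm z ∉ S.cutLocus) :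
    IsKimMcCannAt (chartMetric ((𝓡 n).prod (𝓡 n)) S.h q) z := by
  have : IsManifold ((𝓡 n).prod (𝓡 n)) 4 (M × N) := .of_le (n := ∞) four_le_infty
  have hcont : ContinuousAt (extChartAt ((𝓡 n).prod (𝓡 n)) q).symm z :=
    ((contMDiffOn_extChartAt_symm (n := 4) q).contMDiffAt
      ((isOpen_extChartAt_target q).mem_nhds hz)).continuousAt
  constructor
  · obtain ⟨c, hc, h⟩ := S.exists_cost _ hcut
    refine ⟨fun z => c ((extChartAt ((𝓡 n).prod (𝓡 n)) q).symm z),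
      contDiffAt_comp_extChartAt_symm hz hc, ?_⟩
    -- Closedness of the cut locus keeps nearby points off it, so the null and symmetry conditions
    -- are available at each of them.
    filter_upwards [hcont.eventually h,
      hcont.eventually ((contMDiffAt_iff_contMDiffAt_nhds (by simp)).1 hc),
      (isOpen_extChartAt_target q).mem_nhds hz,
      hcont.eventually (S.isClosed_cutLocus.isOpen_compl.mem_nhds hcut)] with y h1 h2 h3 h4 u v
    have k : ∀ a b : Model n, S.h ((extChartAt ((𝓡 n).prod (𝓡 n)) q).symm y)
        (pair _ (chartSymmDeriv q.1 y.1 a) 0) (pair _ 0 (chartSymmDeriv q.2 y.2 b)) = -(1 / 2) *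
        fderiv ℝ (fderiv ℝ fun z => c ((extChartAt ((𝓡 n).prod (𝓡 n)) q).symm z)) y
          (a, 0) (0, b) := fun a b => by
      rw [← crossDeriv_chart h3 h2, ← extChartAt_prod_symm_apply]
      exact h1 _ _
    rw [S.chartMetric_apply h3, S.metric_apply h4, mul_add, ← k, ← k]
  · intro u hu
    have hz' := mem_extChartAt_prod_target.1 hz
    obtain ⟨e₁, he₁⟩ := isInvertible_chartSymmDeriv hz'.1
    obtain ⟨e₂, he₂⟩ := isInvertible_chartSymmDeriv hz'.2
    have h := S.nondegenerate _ hcut (e₁ u.1, e₂ u.2) fun v => by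
      have h1 := hu (e₁.symm v.1, e₂.symm v.2)
      rw [S.chartMetric_apply hz, ← he₁, ← he₂] at h1
      simp only [ContinuousLinearEquiv.coe_coe, ContinuousLinearEquiv.apply_symm_apply] at h1
      exact h1
    have h1 : e₁ u.1 = 0 := congrArg Prod.fst h
    have h2 : e₂ u.2 = 0 := congrArg Prod.snd h
    exact Prod.ext (by simpa using h1) (by simpa using h2)

end Cost

/-! ### The immersion in charts and the globally defined mean curvature form -/

section Immersion

variable {n : ℕ}
  {M : Type*} [TopologicalSpace M] [ChartedSpace (EuclideanSpace ℝ (Fin n)) M]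
  {N : Type*} [TopologicalSpace N] [ChartedSpace (EuclideanSpace ℝ (Fin n)) N]
  {L : Type*} [TopologicalSpace L] [ChartedSpace (EuclideanSpace ℝ (Fin n)) L]

/-- The derivative of a map to a product, as a linear map between fixed vector spaces. -/
def mapDeriv (F : L → M × N) (p : L) : Model n →L[ℝ] Model n × Model n :=
  mfderiv (𝓡 n) ((𝓡 n).prod (𝓡 n)) F p

/-- The expression of a map to a product in the preferred charts at `p` and `F p`. -/
abbrev chartMap (F : L → M × N) (p : L) : Model n → Model n × Model n :=
  writtenInExtChartAt (𝓡 n) ((𝓡 n).prod (𝓡 n)) p F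

/-- The domain of `chartMap F p`. -/
def chartMapDomain (F : L → M × N) (p : L) : Set (Model n) :=
  {y | y ∈ (extChartAt (𝓡 n) p).target ∧
    F ((extChartAt (𝓡 n) p).symm y) ∈ (extChartAt ((𝓡 n).prod (𝓡 n)) (F p)).source}

variable {S : Structure n M N} {F : L → M × N} {p : L} {y : Model n}

theorem mem_chartMapDomain_self (F : L → M × N) (p : L) :
    extChartAt (𝓡 n) p p ∈ chartMapDomain F p := by
  refine ⟨mem_extChartAt_target p, ?_⟩
  rw [extChartAt_to_inv]
  exact mem_extChartAt_source (F p)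

theorem chartMap_self (F : L → M × N) (p : L) :
    chartMap F p (extChartAt (𝓡 n) p p) = extChartAt ((𝓡 n).prod (𝓡 n)) (F p) (F p) := by
  simp only [chartMap, writtenInExtChartAt, Function.comp_apply, extChartAt_to_inv]

theorem extChartAt_symm_chartMap (hy : y ∈ chartMapDomain F p) :
    (extChartAt ((𝓡 n).prod (𝓡 n)) (F p)).symm (chartMap F p y) =
      F ((extChartAt (𝓡 n) p).symm y) :=
  (extChartAt ((𝓡 n).prod (𝓡 n)) (F p)).left_inv hy.2

theorem chartMap_mem_target (hy : y ∈ chartMapDomain F p) :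
    chartMap F p y ∈ (extChartAt ((𝓡 n).prod (𝓡 n)) (F p)).target :=
  (extChartAt ((𝓡 n).prod (𝓡 n)) (F p)).map_source hy.2

theorem chartForm_apply (α : ∀ q : L, TangentSpace (𝓡 n) q →L[ℝ] ℝ) (p : L) (y v : Model n) :
    chartForm (𝓡 n) α p y v =
      (α ((extChartAt (𝓡 n) p).symm y) : Model n →L[ℝ] ℝ) (chartSymmDeriv p y v) := rfl

theorem fderiv_chartMap_self (hF : ContMDiff (𝓡 n) ((𝓡 n).prod (𝓡 n)) 3 F) (p : L) :
    fderiv ℝ (chartMap F p) (extChartAt (𝓡 n) p p) = mapDeriv F p := by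
  have h := ((hF p).mdifferentiableAt (by simp)).mfderiv
  rw [ModelWithCorners.range_eq_univ, fderivWithin_univ] at h
  exact h.symm

section Target

variable [IsManifold (𝓡 n) ∞ M] [IsManifold (𝓡 n) ∞ N]

theorem Structure.chartMetric_self (S : Structure n M N) (q : M × N) :
    chartMetric ((𝓡 n).prod (𝓡 n)) S.h q (extChartAt ((𝓡 n).prod (𝓡 n)) q q) = S.metric q := by
  refine ContinuousLinearMap.ext fun u => ContinuousLinearMap.ext fun v => ?_
  rw [S.chartMetric_apply (mem_extChartAt_target q), extChartAt_to_inv, extChartAt_prod_apply]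
  simp only [chartSymmDeriv_self]
  rfl

theorem meanCurvature_eq (S : Structure n M N) (F : L → M × N) (p : L) :
    (meanCurvature (n := n) ((𝓡 n).prod (𝓡 n)) S.h F p : Model n × Model n) =
      localMeanCurvature (chartMetric ((𝓡 n).prod (𝓡 n)) S.h (F p)) (chartMap F p)
        (extChartAt (𝓡 n) p p) := by
  have h := mfderiv_extChartAt_prod_symm (mem_extChartAt_target (I := (𝓡 n).prod (𝓡 n)) (F p))
  rw [extChartAt_prod_apply] at h
  simp only [chartSymmDeriv_self] at h
  rw [← extChartAt_prod_apply] at h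
  exact congrArg (fun T : Model n × Model n →L[ℝ] Model n × Model n => T (localMeanCurvature
    (chartMetric ((𝓡 n).prod (𝓡 n)) S.h (F p)) (chartMap F p) (extChartAt (𝓡 n) p p))) h

end Target

variable [IsManifold (𝓡 n) ∞ L]

theorem eventually_mem_chartMapDomain (hF : Continuous F) (hy : y ∈ chartMapDomain F p) :
    ∀ᶠ z in 𝓝 y, z ∈ chartMapDomain F p := by
  have h1 : ContinuousAt (fun z => F ((extChartAt (𝓡 n) p).symm z)) y :=
    hF.continuousAt.comp (mdifferentiableAt_extChartAt_symm hy.1).continuousAt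
  filter_upwards [(isOpen_extChartAt_target p).mem_nhds hy.1,
    h1.preimage_mem_nhds ((isOpen_extChartAt_source (F p)).mem_nhds hy.2)] with z h2 h3
    using ⟨h2, h3⟩

variable [IsManifold (𝓡 n) ∞ M] [IsManifold (𝓡 n) ∞ N]

theorem contDiffAt_chartMap (hF : ContMDiff (𝓡 n) ((𝓡 n).prod (𝓡 n)) 3 F)
    (hy : y ∈ chartMapDomain F p) : ContDiffAt ℝ 3 (chartMap F p) y := by
  have h3 : (3 : WithTop ℕ∞) ≤ ∞ := ENat.LEInfty.out
  have : IsManifold ((𝓡 n).prod (𝓡 n)) 3 (M × N) := .of_le (n := ∞) h3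
  have : IsManifold (𝓡 n) 3 L := .of_le (n := ∞) h3
  rw [← contMDiffAt_iff_contDiffAt]
  have h := hy.2
  rw [extChartAt_source] at h
  exact (contMDiffAt_extChartAt' h).comp y
    ((hF _).comp y (contMDiffAt_extChartAt_symm hy.1))

/-- Chain rule applied to ψ⁻¹ ∘ f = F ∘ φ⁻¹, where f is the chart expression of F. -/
theorem chartSymmDeriv_fderiv_chartMap (hF : ContMDiff (𝓡 n) ((𝓡 n).prod (𝓡 n)) 3 F)
    (hy : y ∈ chartMapDomain F p) (a : Model n) :
    (chartSymmDeriv (F p).1 (chartMap F p y).1 (fderiv ℝ (chartMap F p) y a).1,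
      chartSymmDeriv (F p).2 (chartMap F p y).2 (fderiv ℝ (chartMap F p) y a).2) =
      mapDeriv F ((extChartAt (𝓡 n) p).symm y) (chartSymmDeriv p y a) := by
  have : IsManifold ((𝓡 n).prod (𝓡 n)) 3 (M × N) := .of_le (n := ∞) ENat.LEInfty.out
  have h1 : (extChartAt ((𝓡 n).prod (𝓡 n)) (F p)).symm ∘ chartMap F p =ᶠ[𝓝 y]
      F ∘ (extChartAt (𝓡 n) p).symm := by
    filter_upwards [eventually_mem_chartMapDomain hF.continuous hy] with z hz
      using extChartAt_symm_chartMap hz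
  have h2 : MDifferentiableAt 𝓘(ℝ, Model n) 𝓘(ℝ, Model n × Model n) (chartMap F p) y :=
    ((contDiffAt_chartMap hF hy).differentiableAt three_ne_zero).mdifferentiableAt
  have h3 : MDifferentiableAt 𝓘(ℝ, Model n × Model n) ((𝓡 n).prod (𝓡 n))
      (extChartAt ((𝓡 n).prod (𝓡 n)) (F p)).symm (chartMap F p y) :=
    ((contMDiffOn_extChartAt_symm (n := 3) (F p)).contMDiffAt
      ((isOpen_extChartAt_target (F p)).mem_nhds (chartMap_mem_target hy))).mdifferentiableAt
      (by simp)
  have h4 := mfderiv_comp y h3 h2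
  have h5 := mfderiv_comp y ((hF _).mdifferentiableAt (by simp))
    (mdifferentiableAt_extChartAt_symm hy.1)
  rw [h1.mfderiv_eq, mfderiv_eq_fderiv] at h4
  have h6 := congrArg (fun T : Model n →L[ℝ] Model n × Model n => T a) (h4.symm.trans h5)
  have h7 := congrArg (fun T : Model n × Model n →L[ℝ] Model n × Model n =>
    T (fderiv ℝ (chartMap F p) y a)) (mfderiv_extChartAt_prod_symm (chartMap_mem_target hy))
  exact h7.symm.trans h6

theorem Structure.chartMetric_fderiv_chartMap (S : Structure n M N)
    (hF : ContMDiff (𝓡 n) ((𝓡 n).prod (𝓡 n)) 3 F) (hy : y ∈ chartMapDomain F p) (a b : Model n) :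
    chartMetric ((𝓡 n).prod (𝓡 n)) S.h (F p) (chartMap F p y) (fderiv ℝ (chartMap F p) y a)
        (fderiv ℝ (chartMap F p) y b) =
      S.metric (F ((extChartAt (𝓡 n) p).symm y))
        (mapDeriv F ((extChartAt (𝓡 n) p).symm y) (chartSymmDeriv p y a))
        (mapDeriv F ((extChartAt (𝓡 n) p).symm y) (chartSymmDeriv p y b)) := by
  rw [S.chartMetric_apply (chartMap_mem_target hy), chartSymmDeriv_fderiv_chartMap hF hy,
    chartSymmDeriv_fderiv_chartMap hF hy, extChartAt_symm_chartMap hy]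

theorem Structure.chartMetric_modelK_fderiv_chartMap (S : Structure n M N)
    (hF : ContMDiff (𝓡 n) ((𝓡 n).prod (𝓡 n)) 3 F) (hy : y ∈ chartMapDomain F p) (a b : Model n) :
    chartMetric ((𝓡 n).prod (𝓡 n)) S.h (F p) (chartMap F p y)
        (modelK n (fderiv ℝ (chartMap F p) y a)) (fderiv ℝ (chartMap F p) y b) =
      S.metric (F ((extChartAt (𝓡 n) p).symm y))
        (modelK n (mapDeriv F ((extChartAt (𝓡 n) p).symm y) (chartSymmDeriv p y a)))
        (mapDeriv F ((extChartAt (𝓡 n) p).symm y) (chartSymmDeriv p y b)) := by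
  rw [S.chartMetric_apply (chartMap_mem_target hy), chartSymmDeriv_fderiv_chartMap hF hy,
    ← chartSymmDeriv_fderiv_chartMap hF hy a, extChartAt_symm_chartMap hy, modelK_apply,
    modelK_apply, map_neg]

theorem Structure.IsLagrangianImmersion.isLagrangianAt (hF : S.IsLagrangianImmersion F)
    (hnd : S.InducedNondegenerate F) (hy : y ∈ chartMapDomain F p) :
    IsLagrangianAt (chartMetric ((𝓡 n).prod (𝓡 n)) S.h (F p)) (chartMap F p) y where
  isKimMcCannAt := S.isKimMcCannAt_chartMetric (chartMap_mem_target hy) (by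
    rw [extChartAt_symm_chartMap hy]; exact hF.notMem_cutLocus _)
  contDiffAt := contDiffAt_chartMap hF.contMDiff hy
  lagrangian := by
    filter_upwards [eventually_mem_chartMapDomain hF.contMDiff.continuous hy] with z hz a b
    rw [S.chartMetric_modelK_fderiv_chartMap hF.contMDiff hz]
    exact hF.lagrangian _ _ _
  nondegenerate := by
    intro a ha
    obtain ⟨e, he⟩ := isInvertible_chartSymmDeriv hy.1
    have key : ∀ v : Model n, S.metric (F ((extChartAt (𝓡 n) p).symm y))
        (mapDeriv F ((extChartAt (𝓡 n) p).symm y) (e a))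
        (mapDeriv F ((extChartAt (𝓡 n) p).symm y) v) = 0 := fun v => by
      have h1 := ha (e.symm v)
      rw [S.chartMetric_fderiv_chartMap hF.contMDiff hy, ← he] at h1
      simpa only [ContinuousLinearEquiv.coe_coe, ContinuousLinearEquiv.apply_symm_apply] using h1
    have h := hnd ((extChartAt (𝓡 n) p).symm y) (e a) key
    have h1 : e a = 0 := h
    simpa using h1

theorem Structure.IsLagrangianImmersion.meanCurvatureForm_apply (hF : S.IsLagrangianImmersion F)
    (hnd : S.InducedNondegenerate F) (p : L) (w : Model n) :
    (S.meanCurvatureForm F p : Model n →L[ℝ] ℝ) w =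
      logDetForm (chartMetric ((𝓡 n).prod (𝓡 n)) S.h (F p)) (chartMap F p)
        (extChartAt (𝓡 n) p p) w := by
  have hp := mem_chartMapDomain_self (n := n) F p
  rw [← (hF.isLagrangianAt hnd hp).apply_localMeanCurvature, fderiv_chartMap_self hF.contMDiff,
    chartMap_self, S.chartMetric_self, ← meanCurvature_eq]
  · rfl
  · filter_upwards [eventually_mem_chartMapDomain hF.contMDiff.continuous hp] with z hz
      using (hF.isLagrangianAt hnd hz).nondegenerate

/-- At q = φ⁻¹(y) the form is defined through the charts at q and F q, whereas the right side uses
those at p and F p. The two are compared by coordinate invariance, with t the transition from p to q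
on the source and s₁, s₂ those from F q to F p on the factors. -/
theorem Structure.IsLagrangianImmersion.chartForm_meanCurvatureForm
    (hF : S.IsLagrangianImmersion F) (hnd : S.InducedNondegenerate F)
    (hy : y ∈ chartMapDomain F p) :
    chartForm (𝓡 n) (S.meanCurvatureForm F) p y =
      logDetForm (chartMetric ((𝓡 n).prod (𝓡 n)) S.h (F p)) (chartMap F p) y := by
  refine ContinuousLinearMap.ext fun v => ?_
  set q := (extChartAt (𝓡 n) p).symm y with hq
  have hqs : q ∈ (extChartAt (𝓡 n) q).source := mem_extChartAt_source q
  have ht : transition p q y = extChartAt (𝓡 n) q q := rfl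
  have hqd := mem_chartMapDomain_self (n := n) F q
  have hyL := hF.isLagrangianAt hnd hy
  have hq1 : (extChartAt (𝓡 n) (F q).1).symm (extChartAt (𝓡 n) (F q).1 (F q).1) = (F q).1 :=
    extChartAt_to_inv _
  have hq2 : (extChartAt (𝓡 n) (F q).2).symm (extChartAt (𝓡 n) (F q).2 (F q).2) = (F q).2 :=
    extChartAt_to_inv _
  have hsrc : (F q).1 ∈ (extChartAt (𝓡 n) (F p).1).source ∧
      (F q).2 ∈ (extChartAt (𝓡 n) (F p).2).source := by
    have := hy.2
    rw [extChartAt_prod] at this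
    exact this
  have hft : chartMap F q (transition p q y) =
      (extChartAt (𝓡 n) (F q).1 (F q).1, extChartAt (𝓡 n) (F q).2 (F q).2) := by
    rw [ht, chartMap_self, extChartAt_prod_apply]
  have hcont : ContinuousAt (extChartAt (𝓡 n) p).symm y :=
    (mdifferentiableAt_extChartAt_symm hy.1).continuousAt
  rw [chartForm_apply, hF.meanCurvatureForm_apply hnd, chartSymmDeriv_transition hy.1 hqs, ht,
    chartSymmDeriv_self, ContinuousLinearMap.id_comp]
  refine (IsLagrangianAt.logDetForm_comp (t := transition p q)
    (s₁ := transition (F q).1 (F p).1) (s₂ := transition (F q).2 (F p).2)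
    (hF.isLagrangianAt hnd hqd) hyL.isKimMcCannAt
    ((contDiffAt_transition hy.1 hqs).of_le ENat.LEInfty.out)
    (isInvertible_fderiv_transition hy.1 hqs) ?_ ?_ ?_ ?_ ?_ ?_ v).symm
  · rw [hft]
    exact (contDiffAt_transition (mem_extChartAt_target _) (by rw [hq1]; exact hsrc.1)).of_le
      ENat.LEInfty.out
  · rw [hft]
    exact isInvertible_fderiv_transition (mem_extChartAt_target _) (by rw [hq1]; exact hsrc.1)
  · rw [hft]
    exact (contDiffAt_transition (mem_extChartAt_target _) (by rw [hq2]; exact hsrc.2)).of_le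
      ENat.LEInfty.out
  · rw [hft]
    exact isInvertible_fderiv_transition (mem_extChartAt_target _) (by rw [hq2]; exact hsrc.2)
  · have h1 : ContinuousAt (fun z => F ((extChartAt (𝓡 n) p).symm z)) y :=
      hF.contMDiff.continuous.continuousAt.comp hcont
    filter_upwards [hcont.preimage_mem_nhds ((isOpen_extChartAt_source q).mem_nhds hqs),
      h1.preimage_mem_nhds ((isOpen_extChartAt_source (I := (𝓡 n).prod (𝓡 n)) (F q)).mem_nhds
        (mem_extChartAt_source (F q)))] with z h2 h3
    have h4 : chartMap F q (transition p q z) =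
        extChartAt ((𝓡 n).prod (𝓡 n)) (F q) (F ((extChartAt (𝓡 n) p).symm z)) := by
      simp only [chartMap, writtenInExtChartAt, Function.comp_apply, transition]
      rw [(extChartAt (𝓡 n) q).left_inv h2]
    rw [Set.mem_preimage, extChartAt_prod] at h3
    rw [h4, extChartAt_prod_apply]
    simp only [transition]
    rw [(extChartAt (𝓡 n) (F q).1).left_inv h3.1, (extChartAt (𝓡 n) (F q).2).left_inv h3.2,
      ← extChartAt_prod_apply]
    rfl
  · have : IsManifold ((𝓡 n).prod (𝓡 n)) 3 (M × N) := .of_le (n := ∞) ENat.LEInfty.out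
    have htar := chartMap_mem_target hqd
    have h1 : ContinuousAt (extChartAt ((𝓡 n).prod (𝓡 n)) (F q)).symm
        (chartMap F q (extChartAt (𝓡 n) q q)) :=
      ((contMDiffOn_extChartAt_symm (n := 3) (F q)).contMDiffAt
        ((isOpen_extChartAt_target (F q)).mem_nhds htar)).continuousAt
    have h2 : (extChartAt ((𝓡 n).prod (𝓡 n)) (F q)).symm (chartMap F q (extChartAt (𝓡 n) q q)) ∈
        (extChartAt ((𝓡 n).prod (𝓡 n)) (F p)).source := by
      rw [extChartAt_symm_chartMap hqd, extChartAt_to_inv]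
      exact hy.2
    filter_upwards [(isOpen_extChartAt_target (F q)).mem_nhds htar,
      h1.preimage_mem_nhds ((isOpen_extChartAt_source (F p)).mem_nhds h2)] with z h3 h4 u v
    exact S.chartMetric_transition h3 h4 u v

end Immersion

end KimMcCann

end

theorem mainTheorem6 (n : ℕ)
    {M : Type*} [TopologicalSpace M] [ChartedSpace (EuclideanSpace ℝ (Fin n)) M]
    [IsManifold (𝓡 n) ∞ M]
    {N : Type*} [TopologicalSpace N] [ChartedSpace (EuclideanSpace ℝ (Fin n)) N]
    [IsManifold (𝓡 n) ∞ N]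
    {L : Type*} [TopologicalSpace L] [ChartedSpace (EuclideanSpace ℝ (Fin n)) L]
    [IsManifold (𝓡 n) ∞ L]
    (S : KimMcCann.Structure n M N) (F : L → M × N)
    (hF : S.IsLagrangianImmersion F) (hnd : S.InducedNondegenerate F) :
    KimMcCann.IsC1Form (𝓡 n) (S.meanCurvatureForm F) ∧
    ∀ (p : L) (u v : TangentSpace (𝓡 n) p),
      KimMcCann.extDerivForm (𝓡 n) (S.meanCurvatureForm F) p u v =
        KimMcCann.ricci ((𝓡 n).prod (𝓡 n)) S.h (F p)
          (KimMcCann.paraK (F p) (mfderiv (𝓡 n) ((𝓡 n).prod (𝓡 n)) F p u))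
          (mfderiv (𝓡 n) ((𝓡 n).prod (𝓡 n)) F p v) := by
  -- Equality on a whole neighbourhood of the base point is what transfers both the C¹ regularity
  -- and the first derivatives.
  have hev : ∀ p : L, KimMcCann.chartForm (𝓡 n) (S.meanCurvatureForm F) p
      =ᶠ[𝓝 (extChartAt (𝓡 n) p p)] KimMcCann.logDetForm
        (KimMcCann.chartMetric ((𝓡 n).prod (𝓡 n)) S.h (F p)) (KimMcCann.chartMap F p) := by
    intro p
    filter_upwards [KimMcCann.eventually_mem_chartMapDomain hF.contMDiff.continuous
      (KimMcCann.mem_chartMapDomain_self F p)] with y hy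
      using hF.chartForm_meanCurvatureForm hnd hy
  have hL := fun p => hF.isLagrangianAt hnd (KimMcCann.mem_chartMapDomain_self F p)
  refine ⟨fun p => (hL p).contDiffAt_logDetForm.congr_of_eventuallyEq (hev p), fun p u v => ?_⟩
  have : IsManifold (𝓡 n) 1 L := .of_le (n := ∞) ENat.LEInfty.out
  have : IsManifold ((𝓡 n).prod (𝓡 n)) 1 (M × N) := .of_le (n := ∞) ENat.LEInfty.out
  have h := (hL p).fderiv_logDetForm_sub u v
  rw [← (hev p).fderiv_eq, KimMcCann.fderiv_chartMap_self hF.contMDiff, KimMcCann.chartMap_self]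
    at h
  rw [KimMcCann.extDerivForm, KimMcCann.ricci, mfderiv_extChartAt_self, mfderiv_extChartAt_self]
  exact h
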